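/- Let $n\ge 0$ be an integer, $q\in\mathbb C\setminus\{0,1\}$, and fix a value of $\ln q$; put $q^\lambda=e^{\lambda\ln q}$ for $\lambda\in\mathbb C$. A generalized power series is a formal series $\varphi=\sum_{k\ge1}c_kx^{\lambda_k}$ with $c_k,\lambda_k\in\mathbb C$ and $0<\operatorname{Re}\lambda_1\le\operatorname{Re}\lambda_2\le\dots\to+\infty$; let $\sigma\varphi=\sum_k c_kq^{\lambda_k}x^{\lambda_k}$. Let $F(x,y_0,\dots,y_n)$ be holomorphic in a neighbourhood of $0\in\mathbb C^{n+2}$, and let a generalized power series $\varphi$ satisfy formally the $q$-difference equation $$F(x,\varphi,\sigma\varphi,\dots,\sigma^n\varphi)=0 .$$ Assume that there are $\nu\in\mathbb C$ and $A_0,\dots,A_n\in\mathbb C$, not all zero, such that for every $j=0,\dots,n$ $$F'_{y_j}(x,\varphi,\sigma\varphi,\dots,\sigma^n\varphi)=A_jx^\nu+o(x^\nu),$$ where $o(x^\nu)$ denotes a formal series all of whose exponents have real part greater than $\operatorname{Re}\nu$. Let $L(z)=A_nz^n+\dots+A_1z+A_0$. Let $\rho_1,\dots,\rho_\tau$ be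 complex numbers with positive real parts, linearly independent over $\mathbb Z$, such that every exponent of $\varphi$ (with non-zero coefficient) has the form $m_1\rho_1+\dots+m_\tau\rho_\tau$ with $m_i\in\mathbb Z_{\ge0}$. For $a\neq0$ consider the Diophantine condition: there are $c,\gamma>0$ such that $$|(m_1\rho_1+\dots+m_\tau\rho_\tau)\ln q-\ln a-2\pi m\mathrm i|>c\,(m_1+\dots+m_\tau)^{-\gamma}\qquad(\ast)$$ for all $(m_1,\dots,m_\tau)\in\mathbb Z_{\ge0}^\tau\setminus\{0\}$ and all $m\in\mathbb Z$. Suppose that at least one of the following holds: (a) $A_0\ne0$ and $|q^{\rho_i}|<1$ for all $i$; (b) $A_n\ne0$ and $|q^{\rho_i}|>1$ for all $i$; (c) $|q^{\rho_i}|=1$ for all $i$, and $(\ast)$ holds for every root $a$ of $(z-1)L(z)$ with $|a|=1$; (d) $A_0\ne0$, $|q^{\rho_i}|\le1$ for all $i$, and $(\ast)$ holds for every root $a$ of $(z-1)L(z)$ with $|a|\le1$; (e) $A_n\ne0$, $|q^{\rho_i}|\ge1$ for all $i$, and $(\ast)$ holds for every root $a$ of $(z-1)L(z)$ with $|a|\ge1$.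 Then $\varphi$ converges uniformly in every sector with vertex at $0$, of opening less than $2\pi$ and of sufficiently small radius. -/

import Mathlib

open Filter

noncomputable section

namespace QDiff

/-- A formal series `∑ φ μ x ^ μ` with complex exponents is encoded by its coefficient function
`φ : ℂ → ℂ`. It is a generalized power series if all exponents occurring in it have positive real
part and only finitely many of them lie in each half-plane `re μ ≤ B`, so that
`φ = ∑ₖ cₖ x ^ λₖ` with `0 < re λ₁ ≤ re λ₂ ≤ … → +∞`. -/
def IsGenPowerSeries (φ : ℂ → ℂ) : Prop :=
  (∀ μ, φ μ ≠ 0 → 0 < μ.re) ∧ ∀ B : ℝ, {μ : ℂ | φ μ ≠ 0 ∧ μ.re ≤ B}.Finite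

/-- The series consisting of the single monomial `x ^ μ`. -/
def monom (μ : ℂ) : ℂ → ℂ := Pi.single μ 1

/-- The product of two series: the coefficient of `x ^ ν` is the sum of the products of
coefficients over all pairs of exponents with sum `ν`. For series with finitely many exponents in
each half-plane `re μ ≤ B` and none with negative real part this sum is finite. -/
def mul (f g : ℂ → ℂ) : ℂ → ℂ := fun ν => ∑ᶠ μ, f μ * g (ν - μ)

/-- Powers of a series. -/
def pow (f : ℂ → ℂ) : ℕ → ℂ → ℂ
  | 0 => monom 0
  | k + 1 => mul (pow f k) f

/-- The product of a finite family of series. -/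
def prod {k : ℕ} (f : Fin k → ℂ → ℂ) : ℂ → ℂ := (List.ofFn f).foldr mul (monom 0)

/-- Formal substitution of the series `Φ i` for the variables of a power series `f`:
`∑_d f_d ∏ i, (Φ i) ^ (d i)`. If all `Φ i` are generalized power series, only finitely many `d`
contribute to each coefficient. -/
def subst {k : ℕ} (f : MvPowerSeries (Fin k) ℂ) (Φ : Fin k → ℂ → ℂ) : ℂ → ℂ :=
  fun ν => ∑ᶠ d : Fin k →₀ ℕ, MvPowerSeries.coeff d f * prod (fun i => pow (Φ i) (d i)) ν

/-- The operator `σ : y(x) ↦ y(qx)` on series: `x ^ μ ↦ q ^ μ x ^ μ`, where `q ^ μ = exp (μ ℓ)`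
and `ℓ` is the chosen value of `ln q`. -/
def shift (ℓ : ℂ) (φ : ℂ → ℂ) : ℂ → ℂ := fun μ => Complex.exp (μ * ℓ) * φ μ

/-- The tuple `(x, φ, σφ, …, σⁿφ)`; index `0` is the variable `x`, index `j + 1` is `y_j`. -/
def tuple (n : ℕ) (ℓ : ℂ) (φ : ℂ → ℂ) : Fin (n + 2) → ℂ → ℂ :=
  Fin.cons (monom 1) (fun j : Fin (n + 1) => (shift ℓ)^[j] φ)

/-- `F` is holomorphic near `0` with Taylor series `f`. -/
def HasTaylorSeries {k : ℕ} (F : (Fin k → ℂ) → ℂ) (f : MvPowerSeries (Fin k) ℂ) : Prop :=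
  ∃ r : ℝ, 0 < r ∧ ∀ z : Fin k → ℂ, (∀ i, ‖z i‖ < r) →
    HasSum (fun d : Fin k →₀ ℕ => MvPowerSeries.coeff d f * ∏ i, z i ^ d i) (F z)

/-- `g = A x ^ ν + o(x ^ ν)`: all other exponents of `g` have real part greater than `re ν`. -/
def HasLeadingTerm (g : ℂ → ℂ) (A ν : ℂ) : Prop :=
  g ν = A ∧ ∀ μ, μ ≠ ν → μ.re ≤ ν.re → g μ = 0

/-- The polynomial `L(z) = Aₙ zⁿ + … + A₁ z + A₀`. -/
def charPoly {n : ℕ} (A : Fin (n + 1) → ℂ) : Polynomial ℂ :=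
  ∑ j : Fin (n + 1), Polynomial.C (A j) * Polynomial.X ^ (j : ℕ)

/-- The Diophantine condition at `a ≠ 0` for the generators `ρ₁, …, ρ_τ`, with `ℓ = ln q`.
As `k` runs through `ℤ`, the choice of the value of `ln a` is immaterial. -/
def Diophantine {τ : ℕ} (ℓ : ℂ) (ρ : Fin τ → ℂ) (a : ℂ) : Prop :=
  ∃ c γ : ℝ, 0 < c ∧ 0 < γ ∧ ∀ m : Fin τ → ℕ, m ≠ 0 → ∀ k : ℤ,
    c * ((∑ i, m i : ℕ) : ℝ) ^ (-γ) <
      ‖(∑ i, (m i : ℂ) * ρ i) * ℓ - Complex.log a - 2 * Real.pi * k * Complex.I‖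

/-- The open sector with vertex `0` and radius `R`, bounded by the rays of directions `α` and `β`,
in polar coordinates `(r, θ)`, `x = r e^{iθ}`. -/
def sector (α β R : ℝ) : Set (ℝ × ℝ) := Set.Ioo 0 R ×ˢ Set.Ioo α β

/-- The value `x ^ μ = exp (μ (ln r + iθ))` at `x = r e^{iθ}`; in a sector of opening less than
`2π` this is a single-valued holomorphic branch. -/
def cpowPolar (μ : ℂ) (p : ℝ × ℝ) : ℂ :=
  Complex.exp (μ * ((Real.log p.1 : ℂ) + p.2 * Complex.I))

/-- In every sector with vertex `0`, opening less than `2π` and sufficiently small radius, the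
series `∑ φ μ x ^ μ` converges uniformly (in any order of summation). -/
def ConvergesInSectors (φ : ℂ → ℂ) : Prop :=
  ∀ α β : ℝ, α < β → β - α < 2 * Real.pi → ∃ R : ℝ, 0 < R ∧ ∃ S : ℝ × ℝ → ℂ,
    TendstoUniformlyOn (fun (T : Finset ℂ) (p : ℝ × ℝ) => ∑ μ ∈ T, φ μ * cpowPolar μ p)
      S atTop (sector α β R)

end QDiff

end

/-! The argument is a weighted majorant estimate, with small divisors absorbed into the weight.
Choose `δ > 0` so that, beyond `A_j x^ν`, the series `F'_{y_j}(x, φ, …)` have only exponents of real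
part at least `Re ν + δ`, and put `s = ν + δ`. Write the tuple `(x, φ, …, σⁿφ)` as `V + x^s W` with
`V` its truncation at real part `N`. Expanding `F` to second order around `V` and comparing
coefficients at `x^(λ+ν)` gives `L(q^λ) φ_λ = -(…)`, where the right side involves only coefficients
of `φ` whose exponents have real part at most `Re λ - δ` (`coefficient_identity`).

All terms are measured in the `ℓ¹` norm with weight `r^t e^(-h t)`, `t` being the real part of the
exponent. If `h` is superadditive and non-negative, the norm is submultiplicative, so substitution
in a convergent series is bounded. If moreover `|q^λ|^j e^(h t) ≤ C |L(q^λ)| e^(h(Re λ - s))` for `t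
< Re λ - s`, division by `L(q^λ)` costs a constant, while the step of length `δ` gains `r^δ`. For
small `r` a bound on the weighted sum up to real part `T` therefore reproduces itself up to `T + δ`
(`partialSum_le`, `summable_of_potential`). Since `h` grows at most linearly, this gives geometric
bounds. All exponents lie in the cone generated by the `ρ_i`, where imaginary parts are dominated by
real parts, hence convergence in sectors.

It remains to find `h`. If `q^λ` tends to `0` or to `∞` along the exponents, `A_0` or `A_n`
dominates `L` and `h = 0` works. In the Diophantine cases `L(q^λ) ≠ 0` at every exponent. Then every
exponent is rational: otherwise apply to the equation a derivation `x^κ ↦ χ(κ) x^κ` with `χ` a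
`ℚ`-linear functional vanishing at `1`; the lowest exponent with `χ(λ) ≠ 0` would satisfy `L(q^λ) =
0` (`exists_resonance`). For rational exponents the sign of `Re ln q` decides between decay, growth
and `|q^λ| = 1`, and linear independence of the `ρ_i` makes all multi-indices proportional.

On the unit circle, two exponents with `q^p` and `q^p'` both near a root `a` have `q^(p'-p)` near
`1`, so the condition at `1` keeps them far apart, and the condition at `a` keeps them far from `0`.
Near-resonances of strength `e^(-n-1)` thus have gaps at least `Q n`, with `Q n` growing
exponentially in `n`. The potential `h` is a sum over `n` of superadditive functions jumping by one
at each such point (`exists_potential`). -/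

noncomputable section

namespace QDiff

/-! ### The potential controlling products of small divisors -/

/-- The values whose supremum is the counting potential `resonanceCount R Q t`. -/
def resonanceValues (R : Set ℝ) (Q t : ℝ) : Set ℝ :=
  {y | y = 0 ∨ y = 2 * t / Q - 2 ∨ ∃ p ∈ R, p ≤ t ∧ y = 2 * p / Q - 1}

/-- A superadditive function of `t` that jumps by at least one at each point of the set `R`,
provided that the gaps of `R ∪ {0}` are at least `Q`. -/
def resonanceCount (R : Set ℝ) (Q t : ℝ) : ℝ := sSup (resonanceValues R Q t)

section Count

variable {R : Set ℝ} {Q : ℝ}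

theorem resonanceValues_le (hQ : 0 < Q) {t y : ℝ} (hy : y ∈ resonanceValues R Q t) :
    y ≤ max 0 (2 * t / Q - 1) := by
  rcases hy with rfl | rfl | ⟨p, -, hp, rfl⟩
  · exact le_max_left _ _
  · exact le_max_of_le_right (by linarith)
  · refine le_max_of_le_right ?_
    gcongr

theorem le_resonanceCount (hQ : 0 < Q) {t y : ℝ} (hy : y ∈ resonanceValues R Q t) :
    y ≤ resonanceCount R Q t :=
  le_csSup ⟨_, fun _ h => resonanceValues_le hQ h⟩ hy

theorem resonanceCount_le {t b : ℝ} (h : ∀ y ∈ resonanceValues R Q t, y ≤ b) :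
    resonanceCount R Q t ≤ b :=
  csSup_le ⟨0, Or.inl rfl⟩ h

theorem resonanceCount_nonneg (hQ : 0 < Q) (t : ℝ) : 0 ≤ resonanceCount R Q t :=
  le_resonanceCount hQ (Or.inl rfl)

theorem resonanceCount_le_max (hQ : 0 < Q) (t : ℝ) :
    resonanceCount R Q t ≤ max 0 (2 * t / Q - 1) :=
  resonanceCount_le fun _ h => resonanceValues_le hQ h

theorem resonanceCount_mono (hQ : 0 < Q) : Monotone (resonanceCount R Q) := by
  intro t t' h
  refine resonanceCount_le ?_
  rintro y (rfl | rfl | ⟨p, hp, hpt, rfl⟩)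
  · exact resonanceCount_nonneg hQ _
  · refine le_trans ?_ (le_resonanceCount hQ (Or.inr (Or.inl rfl)))
    gcongr
  · exact le_resonanceCount hQ (Or.inr (Or.inr ⟨p, hp, hpt.trans h, rfl⟩))

/-- If both summands are positive, each is at most `2 t / Q - 1`, and the sum of these bounds is the
listed value `2 (t + t') / Q - 2`. If one of them vanishes, monotonicity suffices. -/
theorem resonanceCount_add (hQ : 0 < Q) {t t' : ℝ} (ht : 0 ≤ t) (ht' : 0 ≤ t') :
    resonanceCount R Q t + resonanceCount R Q t' ≤ resonanceCount R Q (t + t') := by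
  have h1 := resonanceCount_le_max (R := R) hQ t
  have h2 := resonanceCount_le_max (R := R) hQ t'
  rcases le_max_iff.1 h1 with h1 | h1
  · have := resonanceCount_mono (R := R) hQ (show t' ≤ t + t' by linarith)
    linarith
  rcases le_max_iff.1 h2 with h2 | h2
  · have := resonanceCount_mono (R := R) hQ (show t ≤ t + t' by linarith)
    linarith
  have := le_resonanceCount (R := R) hQ (t := t + t') (Or.inr (Or.inl rfl))
  have e : 2 * (t + t') / Q = 2 * t / Q + 2 * t' / Q := by ring
  linarith

/-- The value at `p` is at least `2 p / Q - 1`. The gaps force every value available at `t < p` to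
be at most `2 p / Q - 2`. -/
theorem resonanceCount_jump (hQ : 0 < Q) (hmin : ∀ p ∈ R, Q ≤ p)
    (hgap : ∀ p ∈ R, ∀ p' ∈ R, p < p' → Q ≤ p' - p) {t p : ℝ} (hp : p ∈ R) (htp : t < p) :
    resonanceCount R Q t + 1 ≤ resonanceCount R Q p := by
  have h1 := le_resonanceCount hQ (t := p) (Or.inr (Or.inr ⟨p, hp, le_rfl, rfl⟩))
  suffices resonanceCount R Q t ≤ 2 * p / Q - 2 by linarith
  refine resonanceCount_le ?_
  rintro y (rfl | rfl | ⟨p', hp', hpt, rfl⟩)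
  · have : 1 ≤ p / Q := (one_le_div hQ).2 (hmin p hp)
    have e : 2 * p / Q = 2 * (p / Q) := by ring
    linarith
  · gcongr
  · have : 1 ≤ (p - p') / Q := (one_le_div hQ).2 (hgap p' hp' p hp (hpt.trans_lt htp))
    have e : 2 * p / Q = 2 * p' / Q + 2 * ((p - p') / Q) := by ring
    linarith

theorem resonanceCount_le_mul (hQ : 0 < Q) {t : ℝ} (ht : 0 ≤ t) :
    resonanceCount R Q t ≤ 2 * t * Q⁻¹ := by
  refine (resonanceCount_le_max hQ t).trans (max_le (by positivity) ?_)
  rw [div_eq_mul_inv]; linarith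

end Count

/-- Superadditive functions on the half-line with at most linear growth. -/
structure IsPotential (h : ℝ → ℝ) : Prop where
  nonneg : ∀ t, 0 ≤ t → 0 ≤ h t
  add_le : ∀ t t', 0 ≤ t → 0 ≤ t' → h t + h t' ≤ h (t + t')
  linear : ∃ K : ℝ, ∀ t, 0 ≤ t → h t ≤ K * t

theorem IsPotential.zero : IsPotential 0 :=
  ⟨fun _ _ => le_rfl, fun _ _ _ _ => by simp, 0, fun _ _ => by simp⟩

theorem IsPotential.add {g h : ℝ → ℝ} (hg : IsPotential g) (hh : IsPotential h) :
    IsPotential (g + h) := by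
  obtain ⟨K, hK⟩ := hg.linear
  obtain ⟨K', hK'⟩ := hh.linear
  refine ⟨fun t ht => add_nonneg (hg.nonneg t ht) (hh.nonneg t ht), fun t t' ht ht' => ?_,
    K + K', fun t ht => ?_⟩
  · have := hg.add_le t t' ht ht'
    have := hh.add_le t t' ht ht'
    simp only [Pi.add_apply]; linarith
  · have := hK t ht
    have := hK' t ht
    simp only [Pi.add_apply]; linarith

/-- A potential absorbing the divisors `ε p`, `p ∈ P`: if those with `ε p ≤ e^{-n-1}` are at
distance at least `Q n` from each other and from `0`, and `∑ 1 / Q n < ∞`. -/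
theorem exists_potential {P : Set ℝ} {ε : ℝ → ℝ} {Q : ℕ → ℝ} (hQ : ∀ n, 0 < Q n)
    (hsum : Summable fun n => (Q n)⁻¹)
    (hε : ∀ p ∈ P, 0 < ε p)
    (hmin : ∀ n : ℕ, ∀ p ∈ P, ε p ≤ Real.exp (-(n + 1)) → Q n ≤ p)
    (hgap : ∀ n : ℕ, ∀ p ∈ P, ∀ p' ∈ P, ε p ≤ Real.exp (-(n + 1)) → ε p' ≤ Real.exp (-(n + 1)) →
      p < p' → Q n ≤ p' - p) :
    ∃ h, IsPotential h ∧ ∀ p ∈ P, ∀ t, 0 ≤ t → t < p →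
      Real.exp (h t) ≤ Real.exp 1 * ε p * Real.exp (h p) := by
  set R : ℕ → Set ℝ := fun n => {p | p ∈ P ∧ ε p ≤ Real.exp (-(n + 1))} with hR
  have hs : ∀ t, 0 ≤ t → Summable fun n => resonanceCount (R n) (Q n) t := fun t ht =>
    Summable.of_nonneg_of_le (fun n => resonanceCount_nonneg (hQ n) t)
      (fun n => resonanceCount_le_mul (hQ n) ht) (hsum.mul_left (2 * t))
  refine ⟨fun t => ∑' n, resonanceCount (R n) (Q n) t, ⟨?_, ?_, ?_⟩, ?_⟩
  · exact fun t _ => tsum_nonneg fun n => resonanceCount_nonneg (hQ n) t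
  · intro t t' ht ht'
    rw [← (hs t ht).tsum_add (hs t' ht')]
    exact ((hs t ht).add (hs t' ht')).tsum_le_tsum
      (fun n => resonanceCount_add (hQ n) ht ht') (hs _ (by linarith))
  · refine ⟨2 * ∑' n, (Q n)⁻¹, fun t ht => ?_⟩
    calc ∑' n, resonanceCount (R n) (Q n) t ≤ ∑' n, 2 * t * (Q n)⁻¹ :=
          (hs t ht).tsum_le_tsum (fun n => resonanceCount_le_mul (hQ n) ht)
            (hsum.mul_left (2 * t))
      _ = _ := by rw [tsum_mul_left]; ring
  · intro p hp t ht htp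
    have hp0 : 0 ≤ p := ht.trans htp.le
    set E := -Real.log (ε p) with hE
    have hεE : ε p = Real.exp (-E) := by rw [hE, neg_neg, Real.exp_log (hε p hp)]
    set M := ⌊E⌋₊ with hM
    have hME : E - 1 ≤ M := by
      have := Nat.lt_floor_add_one E
      linarith
    -- The point `p` belongs to every level `n < M`, and each of them contributes a jump of one.
    -- Rounding `E` down loses at most one, whence the factor `e` in the conclusion.
    have key : (M : ℝ) ≤
        ∑' n, (resonanceCount (R n) (Q n) p - resonanceCount (R n) (Q n) t) := by
      calc (M : ℝ) = ∑ n ∈ Finset.range M, (1 : ℝ) := by simp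
        _ ≤ ∑ n ∈ Finset.range M,
            (resonanceCount (R n) (Q n) p - resonanceCount (R n) (Q n) t) := by
          refine Finset.sum_le_sum fun n hn => ?_
          have hn' : ((n + 1 : ℕ) : ℝ) ≤ E := by
            have h1 : n + 1 ≤ M := Finset.mem_range.1 hn
            exact (Nat.le_floor_iff' (by omega)).1 h1
          have hmem : p ∈ R n := by
            refine ⟨hp, ?_⟩
            rw [hεE]
            apply Real.exp_le_exp.2
            push_cast at hn'
            linarith
          have := resonanceCount_jump (hQ n) (fun p h => hmin n p h.1 h.2)
            (fun p h p' h' => hgap n p h.1 p' h'.1 h.2 h'.2) hmem htp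
          linarith
        _ ≤ _ := ((hs p hp0).sub (hs t ht)).sum_le_tsum _ fun n _ =>
          sub_nonneg.2 (resonanceCount_mono (hQ n) htp.le)
    rw [(hs p hp0).tsum_sub (hs t ht)] at key
    rw [hεE, ← Real.exp_add, ← Real.exp_add]
    apply Real.exp_le_exp.2
    linarith

/-- A lower bound for `d` resulting from `c d ^ (-γ) ≤ b e^{-n-1}`. -/
theorem le_of_mul_rpow_neg_le {c γ b d : ℝ} (hc : 0 < c) (hγ : 0 < γ) (hb : 0 < b) (hd : 0 < d)
    {n : ℕ} (h : c * d ^ (-γ) ≤ b * Real.exp (-(n + 1))) :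
    (c / b) ^ γ⁻¹ * Real.exp ((n + 1) * γ⁻¹) ≤ d := by
  have h1 : c / b * Real.exp (n + 1) ≤ d ^ γ := by
    rw [Real.rpow_neg hd.le, Real.exp_neg, ← div_eq_mul_inv, ← div_eq_mul_inv,
      div_le_div_iff₀ (Real.rpow_pos_of_pos hd _) (Real.exp_pos _)] at h
    rw [div_mul_eq_mul_div, div_le_iff₀ hb]
    linarith
  have h2 := Real.rpow_le_rpow (by positivity) h1 (inv_nonneg.2 hγ.le)
  rwa [← Real.rpow_mul hd.le, mul_inv_cancel₀ hγ.ne', Real.rpow_one,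
    Real.mul_rpow (by positivity) (Real.exp_pos _).le, ← Real.exp_mul] at h2

theorem summable_inv_mul_exp {K γ : ℝ} (hγ : 0 < γ) :
    Summable fun n : ℕ => (K * Real.exp ((n + 1) * γ⁻¹))⁻¹ := by
  have h := (Real.summable_exp_nat_mul_iff (a := -γ⁻¹)).2 (by simpa using hγ)
  refine (h.mul_left (K⁻¹ * Real.exp (-γ⁻¹))).congr fun n => ?_
  rw [mul_inv, ← Real.exp_neg, mul_assoc, ← Real.exp_add]
  congr 2
  ring

/-- The potential for the divisors `u p - a`. -/
theorem exists_potential_sub {P : Set ℝ} {u : ℝ → ℂ} {a : ℂ} (hP : ∀ p ∈ P, 0 < p)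
    {c γ c' γ' : ℝ} (hc : 0 < c) (hγ : 0 < γ) (hc' : 0 < c') (hγ' : 0 < γ')
    (ha : ∀ p ∈ P, c * p ^ (-γ) ≤ ‖u p - a‖)
    (hu : ∀ p ∈ P, ∀ p' ∈ P, p < p' → c' * (p' - p) ^ (-γ') ≤ ‖u p' - u p‖)
    (s : ℝ) :
    ∃ h, IsPotential h ∧ ∀ p ∈ P, 2 * s ≤ p → ∀ t, 0 ≤ t → t < p - s →
      Real.exp (h t) ≤ Real.exp 1 * ‖u p - a‖ * Real.exp (h (p - s)) := by
  -- The factor `1 / 2` outside the power pays for the translation: `p ≥ 2 s` gives `p - s ≥ p / 2`.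
  -- The `2` inside `c' / 2` arises because two small divisors add up in the difference `u p' - u
  -- p`.
  have hK : 0 < (c / 1) ^ γ⁻¹ / 2 := by positivity
  have hK' : 0 < (c' / 2) ^ γ'⁻¹ := by positivity
  set A : ℕ → ℝ := fun n => (c / 1) ^ γ⁻¹ / 2 * Real.exp ((n + 1) * γ⁻¹) with hA
  set B : ℕ → ℝ := fun n => (c' / 2) ^ γ'⁻¹ * Real.exp ((n + 1) * γ'⁻¹) with hB
  have hA0 : ∀ n, 0 < A n := fun n => by positivity
  have hB0 : ∀ n, 0 < B n := fun n => by positivity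
  -- The divisor sits at `p`, but the jump is needed at `p - s`, so the set is translated by `s`.
  suffices H : ∃ h, IsPotential h ∧ ∀ p ∈ {x | x + s ∈ P ∧ s ≤ x}, ∀ t, 0 ≤ t → t < p →
      Real.exp (h t) ≤ Real.exp 1 * ‖u (p + s) - a‖ * Real.exp (h p) by
    obtain ⟨h, hh, hd⟩ := H
    refine ⟨h, hh, fun p hp hps t ht htp => ?_⟩
    have := hd (p - s) ⟨by simpa using hp, by linarith⟩ t ht htp
    simpa using this
  refine exists_potential (P := {x | x + s ∈ P ∧ s ≤ x}) (ε := fun x => ‖u (x + s) - a‖)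
    (Q := fun n => min (A n) (B n)) (fun n => lt_min (hA0 n) (hB0 n)) ?_ ?_ ?_ ?_
  · refine Summable.of_nonneg_of_le (fun n => (inv_pos.2 (lt_min (hA0 n) (hB0 n))).le)
      (fun n => ?_) ((summable_inv_mul_exp (K := (c / 1) ^ γ⁻¹ / 2) hγ).add
        (summable_inv_mul_exp (K := (c' / 2) ^ γ'⁻¹) hγ'))
    have h1 := (inv_pos.2 (hA0 n)).le
    have h2 := (inv_pos.2 (hB0 n)).le
    rcases min_choice (A n) (B n) with h | h <;> rw [h]
    · exact le_add_of_nonneg_right h2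
    · exact le_add_of_nonneg_left h1
  · rintro x ⟨hx, -⟩
    have h0 := hP _ hx
    exact (by positivity : 0 < c * (x + s) ^ (-γ)).trans_le (ha _ hx)
  · rintro n x ⟨hx, hsx⟩ hε
    have h1 := le_of_mul_rpow_neg_le hc hγ one_pos (hP _ hx)
      ((ha _ hx).trans (hε.trans_eq (one_mul _).symm))
    refine (min_le_left _ _).trans ?_
    simp only [hA]
    linarith
  · rintro n x ⟨hx, -⟩ y ⟨hy, -⟩ hεx hεy hxy
    refine (min_le_right _ _).trans ?_
    refine le_of_mul_rpow_neg_le hc' hγ' two_pos (by linarith) ?_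
    have h1 := hu _ hx _ hy (by linarith)
    have h2 : ‖u (y + s) - u (x + s)‖ ≤ ‖u (y + s) - a‖ + ‖u (x + s) - a‖ := by
      rw [← norm_neg (u (x + s) - a)]
      refine le_trans (le_of_eq ?_) (norm_add_le _ _)
      congr 1; ring
    rw [add_sub_add_right_eq_sub] at h1
    linarith

/-- The potential for a product of divisors `u p - a`. -/
theorem exists_potential_prod {P : Set ℝ} {u : ℝ → ℂ} (hP : ∀ p ∈ P, 0 < p)
    {c' γ' : ℝ} (hc' : 0 < c') (hγ' : 0 < γ')
    (hu : ∀ p ∈ P, ∀ p' ∈ P, p < p' → c' * (p' - p) ^ (-γ') ≤ ‖u p' - u p‖)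
    (s : ℝ) (S : Multiset ℂ)
    (hS : ∀ a ∈ S, ∃ c γ : ℝ, 0 < c ∧ 0 < γ ∧ ∀ p ∈ P, c * p ^ (-γ) ≤ ‖u p - a‖) :
    ∃ h, IsPotential h ∧ ∃ C : ℝ, 0 < C ∧ ∀ p ∈ P, 2 * s ≤ p → ∀ t, 0 ≤ t → t < p - s →
      Real.exp (h t) ≤ C * ‖(S.map fun a => u p - a).prod‖ * Real.exp (h (p - s)) := by
  induction S using Multiset.induction with
  | empty =>
    exact ⟨0, .zero, 1, one_pos, fun p _ _ t _ _ => by simp⟩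
  | cons a S ih =>
    obtain ⟨h, hh, C, hC, hd⟩ := ih fun b hb => hS b (Multiset.mem_cons_of_mem hb)
    obtain ⟨c, γ, hc, hγ, ha⟩ := hS a (Multiset.mem_cons_self _ _)
    obtain ⟨g, hg, hgd⟩ := exists_potential_sub hP hc hγ hc' hγ' ha hu s
    refine ⟨g + h, hg.add hh, Real.exp 1 * C, by positivity, fun p hp hps t ht htp => ?_⟩
    rw [Multiset.map_cons, Multiset.prod_cons, norm_mul]
    simp only [Pi.add_apply, Real.exp_add]
    calc _ ≤ (Real.exp 1 * ‖u p - a‖ * Real.exp (g (p - s))) *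
          (C * ‖(S.map fun a => u p - a).prod‖ * Real.exp (h (p - s))) :=
          mul_le_mul (hgd p hp hps t ht htp) (hd p hp hps t ht htp) (Real.exp_pos _).le
            (by positivity)
      _ = _ := by ring

section

open NNReal

/-! ### Submultiplicative norms -/

/-- Submultiplicative seminorms on commutative `ℂ`-algebras. -/
structure IsAlgNorm {R : Type*} [CommRing R] [Algebra ℂ R] (N : R → ℝ≥0) : Prop where
  zero : N 0 = 0
  add_le : ∀ a b, N (a + b) ≤ N a + N b
  mul_le : ∀ a b, N (a * b) ≤ N a * N b
  algebraMap_le : ∀ c, N (algebraMap ℂ R c) ≤ ‖c‖₊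

namespace IsAlgNorm

variable {R : Type*} [CommRing R] [Algebra ℂ R] {N : R → ℝ≥0}

theorem one_le (hN : IsAlgNorm N) : N 1 ≤ 1 := by
  simpa using hN.algebraMap_le 1

theorem sum_le (hN : IsAlgNorm N) {ι : Type*} (s : Finset ι) (g : ι → R) :
    N (∑ i ∈ s, g i) ≤ ∑ i ∈ s, N (g i) := by
  classical
  induction s using Finset.induction with
  | empty => simp [hN.zero]
  | insert a s ha ih =>
    rw [Finset.sum_insert ha, Finset.sum_insert ha]
    exact (hN.add_le _ _).trans (by gcongr)

theorem prod_le (hN : IsAlgNorm N) {ι : Type*} (s : Finset ι) (g : ι → R) :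
    N (∏ i ∈ s, g i) ≤ ∏ i ∈ s, N (g i) := by
  classical
  induction s using Finset.induction with
  | empty => simpa using hN.one_le
  | insert a s ha ih =>
    rw [Finset.prod_insert ha, Finset.prod_insert ha]
    exact (hN.mul_le _ _).trans (by gcongr)

theorem pow_le (hN : IsAlgNorm N) (a : R) (k : ℕ) : N (a ^ k) ≤ N a ^ k := by
  simpa using hN.prod_le (Finset.range k) fun _ => a

theorem aeval_le (hN : IsAlgNorm N) {σ : Type*} [Fintype σ] (V : σ → R) (P : MvPolynomial σ ℂ) :
    N (MvPolynomial.aeval V P) ≤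
      ∑ d ∈ P.support, ‖MvPolynomial.coeff d P‖₊ * ∏ i, N (V i) ^ d i := by
  rw [MvPolynomial.aeval_eq_eval₂Hom, MvPolynomial.coe_eval₂Hom, MvPolynomial.eval₂_eq']
  refine (hN.sum_le _ _).trans (Finset.sum_le_sum fun d _ => (hN.mul_le _ _).trans ?_)
  refine mul_le_mul' (hN.algebraMap_le _) ((hN.prod_le _ _).trans ?_)
  exact Finset.prod_le_prod' fun i _ => hN.pow_le _ _

/-- A bound that is uniform in all polynomials dominated by a given convergent series. -/
theorem aeval_le_tsum (hN : IsAlgNorm N) {σ : Type*} [Fintype σ] (V : σ → R)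
    (P : MvPolynomial σ ℂ) {c : (σ →₀ ℕ) → ℝ≥0} {b : ℝ≥0} (hV : ∀ i, N (V i) ≤ b)
    (hP : ∀ d, ‖MvPolynomial.coeff d P‖₊ ≤ c d)
    (hc : Summable fun d : σ →₀ ℕ => c d * ∏ i, b ^ d i) :
    N (MvPolynomial.aeval V P) ≤ ∑' d : σ →₀ ℕ, c d * ∏ i, b ^ d i := by
  refine (hN.aeval_le V P).trans (le_trans ?_ (hc.sum_le_tsum P.support fun _ _ => zero_le))
  refine Finset.sum_le_sum fun d _ => mul_le_mul' (hP d) ?_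
  exact Finset.prod_le_prod' fun i _ => pow_le_pow_left' (hV i) _

end IsAlgNorm

/-- The norm on polynomials over a normed algebra. -/
def polyNorm {R : Type*} [CommRing R] (N : R → ℝ≥0) (p : Polynomial R) : ℝ≥0 :=
  p.sum fun _ a => N a

section polyNorm

open Polynomial

variable {R : Type*} [CommRing R] {N : R → ℝ≥0}

theorem polyNorm_zero : polyNorm N (0 : R[X]) = 0 := by simp [polyNorm]

variable [Algebra ℂ R]

theorem polyNorm_eq_sum (hN : IsAlgNorm N) {p : R[X]} {s : Finset ℕ} (hs : p.support ⊆ s) :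
    polyNorm N p = ∑ k ∈ s, N (p.coeff k) := by
  refine Finset.sum_subset hs fun k _ hk => ?_
  simp only [notMem_support_iff.1 hk, hN.zero]

theorem polyNorm_monomial (hN : IsAlgNorm N) (k : ℕ) (a : R) :
    polyNorm N (monomial k a) = N a :=
  sum_monomial_index _ _ hN.zero

theorem polyNorm_C (hN : IsAlgNorm N) (a : R) : polyNorm N (C a) = N a :=
  polyNorm_monomial hN 0 a

theorem polyNorm_add_le (hN : IsAlgNorm N) (p q : R[X]) :
    polyNorm N (p + q) ≤ polyNorm N p + polyNorm N q := by
  rw [polyNorm_eq_sum hN (Polynomial.support_add (p := p) (q := q)),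
    polyNorm_eq_sum hN (Finset.subset_union_left (s₁ := p.support) (s₂ := q.support)),
    polyNorm_eq_sum hN (Finset.subset_union_right (s₁ := p.support) (s₂ := q.support)),
    ← Finset.sum_add_distrib]
  exact Finset.sum_le_sum fun k _ => by rw [coeff_add]; exact hN.add_le _ _

theorem polyNorm_sum_le (hN : IsAlgNorm N) {ι : Type*} (s : Finset ι) (g : ι → R[X]) :
    polyNorm N (∑ i ∈ s, g i) ≤ ∑ i ∈ s, polyNorm N (g i) := by
  classical
  induction s using Finset.induction with
  | empty => simp [polyNorm_zero]
  | insert a s ha ih =>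
    rw [Finset.sum_insert ha, Finset.sum_insert ha]
    exact (polyNorm_add_le hN _ _).trans (by gcongr)

theorem isAlgNorm_polyNorm (hN : IsAlgNorm N) : IsAlgNorm (polyNorm N) where
  zero := polyNorm_zero
  add_le := polyNorm_add_le hN
  mul_le p q := by
    rw [mul_eq_sum_sum]
    refine (polyNorm_sum_le hN _ _).trans ?_
    rw [polyNorm, polyNorm, sum_def, sum_def, Finset.sum_mul_sum]
    refine Finset.sum_le_sum fun i _ => (polyNorm_sum_le hN _ _).trans ?_
    refine Finset.sum_le_sum fun j _ => ?_
    rw [polyNorm_monomial hN]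
    exact hN.mul_le _ _
  algebraMap_le c := by
    rw [Polynomial.algebraMap_apply, polyNorm_C hN]
    exact hN.algebraMap_le c

theorem le_polyNorm (hN : IsAlgNorm N) (p : R[X]) (k : ℕ) : N (p.coeff k) ≤ polyNorm N p := by
  by_cases hk : k ∈ p.support
  · exact Finset.single_le_sum (f := fun k => N (p.coeff k)) (fun _ _ => zero_le) hk
  · rw [notMem_support_iff.1 hk, hN.zero]; exact zero_le

theorem polyNorm_divX_le (hN : IsAlgNorm N) (p : R[X]) : polyNorm N p.divX ≤ polyNorm N p := by
  have h1 : p.divX.support ⊆ Finset.range (p.natDegree + 1) := by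
    intro k hk
    have h := le_natDegree_of_mem_supp k hk
    rw [natDegree_divX_eq_natDegree_tsub_one] at h
    simp; omega
  have h2 : p.support ⊆ Finset.range (p.natDegree + 1 + 1) := by
    intro k hk
    have h := le_natDegree_of_mem_supp k hk
    simp; omega
  rw [polyNorm_eq_sum hN h1, polyNorm_eq_sum hN h2, Finset.sum_range_succ' _ (p.natDegree + 1)]
  simp only [coeff_divX]
  exact le_self_add

/-- In `polyNorm` the variable has norm one, so elements of norm at most one may be substituted for
it. -/
theorem norm_eval_le (hN : IsAlgNorm N) (p : R[X]) {a : R} (ha : N a ≤ 1) :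
    N (p.eval a) ≤ polyNorm N p := by
  rw [eval_eq_sum, sum_def]
  refine (hN.sum_le _ _).trans (Finset.sum_le_sum fun k _ => (hN.mul_le _ _).trans ?_)
  exact mul_le_of_le_one_right' ((hN.pow_le _ _).trans (pow_le_one' ha _))

end polyNorm

/-- The weighted `ℓ¹` norm on a monoid algebra. -/
def wnorm {G : Type*} (w : G → ℝ≥0) (p : AddMonoidAlgebra ℂ G) : ℝ≥0 :=
  p.coeff.sum fun a c => ‖c‖₊ * w a

section wnorm

open AddMonoidAlgebra

variable {G : Type*} {w : G → ℝ≥0}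

theorem wnorm_eq_sum {p : AddMonoidAlgebra ℂ G} {s : Finset G} (hs : p.coeff.support ⊆ s) :
    wnorm w p = ∑ a ∈ s, ‖p.coeff a‖₊ * w a := by
  refine Finset.sum_subset hs fun k _ hk => ?_
  rw [Finsupp.notMem_support_iff.1 hk]; simp

theorem sum_le_wnorm (p : AddMonoidAlgebra ℂ G) (s : Finset G) :
    ∑ a ∈ s, ‖p.coeff a‖₊ * w a ≤ wnorm w p := by
  classical
  rw [wnorm_eq_sum (Finset.subset_union_right (s₁ := s) (s₂ := p.coeff.support))]
  exact Finset.sum_le_sum_of_subset Finset.subset_union_left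

theorem wnorm_single (a : G) (c : ℂ) : wnorm w (single a c) = ‖c‖₊ * w a := by
  rw [wnorm, coeff_single]
  exact Finsupp.sum_single_index (by simp)

theorem wnorm_add_le (p q : AddMonoidAlgebra ℂ G) : wnorm w (p + q) ≤ wnorm w p + wnorm w q := by
  classical
  rw [wnorm_eq_sum (p := p + q) (s := p.coeff.support ∪ q.coeff.support)
      (by rw [coeff_add]; exact Finsupp.support_add),
    wnorm_eq_sum (Finset.subset_union_left (s₁ := p.coeff.support) (s₂ := q.coeff.support)),
    wnorm_eq_sum (Finset.subset_union_right (s₁ := p.coeff.support) (s₂ := q.coeff.support)),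
    ← Finset.sum_add_distrib]
  refine Finset.sum_le_sum fun a _ => ?_
  rw [coeff_add, Finsupp.add_apply, ← add_mul]
  gcongr
  exact nnnorm_add_le _ _

theorem wnorm_zero : wnorm w (0 : AddMonoidAlgebra ℂ G) = 0 := by simp [wnorm]

theorem wnorm_sum_le {ι : Type*} (s : Finset ι) (g : ι → AddMonoidAlgebra ℂ G) :
    wnorm w (∑ i ∈ s, g i) ≤ ∑ i ∈ s, wnorm w (g i) := by
  classical
  induction s using Finset.induction with
  | empty => simp [wnorm_zero]
  | insert a s ha ih =>
    rw [Finset.sum_insert ha, Finset.sum_insert ha]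
    exact (wnorm_add_le _ _).trans (by gcongr)

theorem isAlgNorm_wnorm [AddCommMonoid G] (h0 : w 0 ≤ 1) (hw : ∀ a b, w (a + b) ≤ w a * w b) :
    IsAlgNorm (wnorm w) where
  zero := wnorm_zero
  add_le := wnorm_add_le
  mul_le p q := by
    rw [mul_def]
    refine (wnorm_sum_le _ _).trans ?_
    rw [wnorm, wnorm, Finsupp.sum, Finsupp.sum, Finset.sum_mul_sum]
    refine Finset.sum_le_sum fun a _ => (wnorm_sum_le _ _).trans ?_
    refine Finset.sum_le_sum fun b _ => ?_
    rw [wnorm_single, nnnorm_mul, mul_mul_mul_comm]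
    gcongr
    exact hw a b
  algebraMap_le c := by
    rw [AddMonoidAlgebra.coe_algebraMap, Function.comp_apply, wnorm_single]
    exact mul_le_of_le_one_right' h0

theorem wnorm_mono {w' : G → ℝ≥0} (h : ∀ a, w a ≤ w' a) (p : AddMonoidAlgebra ℂ G) :
    wnorm w p ≤ wnorm w' p :=
  Finset.sum_le_sum fun a _ => mul_le_mul_right (h a) _

/-- The norm of a quotient by a monomial. -/
theorem wnorm_divOf_le [AddCommMonoid G] [IsCancelAdd G] {w' : G → ℝ≥0} {C : ℝ≥0} (g : G)
    (h : ∀ a, w a ≤ C * w' (g + a)) (p : AddMonoidAlgebra ℂ G) :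
    wnorm w (p.divOf g) ≤ C * wnorm w' p := by
  classical
  calc wnorm w (p.divOf g)
      = ∑ a ∈ (p.divOf g).coeff.support, ‖p.coeff (g + a)‖₊ * w a := rfl
    _ ≤ ∑ a ∈ (p.divOf g).coeff.support, C * (‖p.coeff (g + a)‖₊ * w' (g + a)) := by
        refine Finset.sum_le_sum fun a _ => ?_
        calc _ ≤ ‖p.coeff (g + a)‖₊ * (C * w' (g + a)) := by gcongr; exact h a
          _ = _ := by ring
    _ = C * ∑ b ∈ (p.divOf g).coeff.support.map (addLeftEmbedding g), ‖p.coeff b‖₊ * w' b := by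
        rw [Finset.sum_map, Finset.mul_sum]; rfl
    _ ≤ _ := by gcongr; exact sum_le_wnorm _ _

end wnorm

end

section

open AddMonoidAlgebra

/-! ### Truncations of series -/

/-- The exponents with non-negative real part. -/
def halfPlane : AddSubmonoid ℂ where
  carrier := {z | 0 ≤ z.re}
  zero_mem' := by simp
  add_mem' {a b} ha hb := by
    simp only [Set.mem_ofPred_eq, Complex.add_re] at *
    exact add_nonneg ha hb

instance : IsCancelAdd halfPlane :=
  Function.Injective.isCancelAdd _ Subtype.val_injective fun _ _ => rfl

theorem mem_halfPlane {z : ℂ} : z ∈ halfPlane ↔ 0 ≤ z.re := Iff.rfl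

/-- The algebra of finite sums of monomials with exponents in the half-plane. -/
abbrev HPoly := AddMonoidAlgebra ℂ halfPlane

theorem re_nonneg (κ : halfPlane) : 0 ≤ (κ : ℂ).re := κ.2

/-- The series `g` has no exponents with negative real part, and coincides with the finite sum `p`
up to real part `B` of the exponents. -/
def Agrees (B : ℝ) (g : ℂ → ℂ) (p : HPoly) : Prop :=
  (∀ μ : ℂ, μ.re < 0 → g μ = 0) ∧ ∀ κ : halfPlane, (κ : ℂ).re ≤ B → p.coeff κ = g κ

/-- Brings the product of finite sums into the shape of `mul`, which ranges over all of `ℂ`. -/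
theorem coeff_mul_eq_finsum (p q : HPoly) (κ : halfPlane) :
    (p * q).coeff κ = ∑ᶠ μ : ℂ, if h : 0 ≤ μ.re ∧ 0 ≤ (κ - μ : ℂ).re then
      p.coeff ⟨μ, h.1⟩ * q.coeff ⟨κ - μ, h.2⟩ else 0 := by
  classical
  rw [coeff_mul, Finsupp.sum,
    finsum_eq_sum_of_support_subset (s := p.coeff.support.map (Function.Embedding.subtype _))]
  · rw [Finset.sum_map]
    refine Finset.sum_congr rfl fun a _ => ?_
    by_cases h : 0 ≤ (a : ℂ).re ∧ 0 ≤ (κ - a : ℂ).re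
    · have hb : ∀ b : halfPlane, a + b = κ ↔ b = ⟨κ - a, h.2⟩ := fun b => by
        rw [Subtype.ext_iff, Subtype.ext_iff, AddSubmonoid.coe_add]
        exact eq_sub_iff_add_eq'.symm
      refine Eq.trans ?_ (dif_pos h).symm
      simp only [hb, Finsupp.sum]
      rw [Finset.sum_ite_eq']
      split_ifs with h'
      · rfl
      · exact (mul_eq_zero_of_right _ (Finsupp.notMem_support_iff.1 h')).symm
    · refine Eq.trans ?_ (dif_neg h).symm
      refine Finset.sum_eq_zero fun b _ => if_neg fun hab => h ⟨a.2, ?_⟩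
      rw [← hab, AddSubmonoid.coe_add, add_sub_cancel_left]
      exact b.2
  · intro μ hμ
    rw [Function.mem_support] at hμ
    have h : 0 ≤ μ.re ∧ 0 ≤ (κ - μ : ℂ).re := by
      by_contra h
      exact hμ (dif_neg h)
    rw [dif_pos h] at hμ
    simp only [Finset.coe_map, Function.Embedding.subtype_apply, Set.mem_image, Finset.mem_coe,
      Finsupp.mem_support_iff]
    exact ⟨⟨μ, h.1⟩, left_ne_zero_of_mul hμ, rfl⟩

theorem Agrees.mul {B : ℝ} {f g : ℂ → ℂ} {p q : HPoly} (hf : Agrees B f p) (hg : Agrees B g q) :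
    Agrees B (mul f g) (p * q) := by
  refine ⟨fun ν hν => ?_, fun κ hκ => ?_⟩
  · refine (finsum_congr fun μ => ?_).trans finsum_zero
    rcases lt_or_ge μ.re 0 with h | h
    · rw [hf.1 μ h, zero_mul]
    · rw [hg.1 (ν - μ) (by rw [Complex.sub_re]; linarith), mul_zero]
  · rw [coeff_mul_eq_finsum]
    refine finsum_congr fun μ => ?_
    split_ifs with h
    · have h1 := h.1
      have h2 := h.2
      rw [Complex.sub_re] at h2
      rw [hf.2 ⟨μ, h.1⟩ (by simp only; linarith), hg.2 ⟨κ - μ, h.2⟩ (by simp; linarith)]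
    · rw [not_and_or, not_le, not_le] at h
      rcases h with h | h
      · rw [hf.1 μ h, zero_mul]
      · rw [hg.1 _ h, mul_zero]

theorem agrees_monom {B : ℝ} (μ : halfPlane) : Agrees B (monom μ) (single μ 1) := by
  refine ⟨fun ν hν => ?_, fun κ _ => ?_⟩
  · refine Pi.single_eq_of_ne ?_ _
    rintro rfl
    exact hν.not_ge μ.2
  · rw [coeff_single, monom, Pi.single_apply, Finsupp.single_apply]
    simp only [Subtype.ext_iff, eq_comm]

theorem agrees_one {B : ℝ} : Agrees B (monom 0) 1 := agrees_monom 0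

theorem Agrees.pow {B : ℝ} {f : ℂ → ℂ} {p : HPoly} (hf : Agrees B f p) (k : ℕ) :
    Agrees B (pow f k) (p ^ k) := by
  induction k with
  | zero => rw [pow_zero]; exact agrees_one
  | succ k ih => rw [pow_succ]; exact ih.mul hf

theorem Agrees.prod {B : ℝ} {k : ℕ} {f : Fin k → ℂ → ℂ} {p : Fin k → HPoly}
    (h : ∀ i, Agrees B (f i) (p i)) : Agrees B (prod f) (∏ i, p i) := by
  induction k with
  | zero => simpa [QDiff.prod] using agrees_one
  | succ k ih =>
    rw [Fin.prod_univ_succ]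
    have := (h 0).mul (ih (f := fun i => f i.succ) (p := fun i => p i.succ) fun i => h i.succ)
    simpa [QDiff.prod, List.ofFn_succ] using this

/-- All exponents of `p` have real part at least `η`. -/
def MinRe (η : ℝ) (p : HPoly) : Prop := ∀ κ : halfPlane, (κ : ℂ).re < η → p.coeff κ = 0

theorem MinRe.mul {η η' : ℝ} {p q : HPoly} (hp : MinRe η p) (hq : MinRe η' q) :
    MinRe (η + η') (p * q) := by
  classical
  intro κ hκ
  rw [coeff_mul]
  refine Finset.sum_eq_zero fun a ha => Finset.sum_eq_zero fun b hb => if_neg ?_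
  rintro rfl
  have ha' : η ≤ (a : ℂ).re := by
    by_contra h
    exact Finsupp.mem_support_iff.1 ha (hp a (not_le.1 h))
  have hb' : η' ≤ (b : ℂ).re := by
    by_contra h
    exact Finsupp.mem_support_iff.1 hb (hq b (not_le.1 h))
  rw [AddSubmonoid.coe_add, Complex.add_re] at hκ
  linarith

theorem minRe_zero (p : HPoly) : MinRe 0 p := fun κ hκ => absurd hκ (not_lt.2 κ.2)

theorem MinRe.pow {η : ℝ} {p : HPoly} (hp : MinRe η p) (k : ℕ) : MinRe (k * η) (p ^ k) := by
  induction k with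
  | zero => simpa using minRe_zero _
  | succ k ih =>
    rw [pow_succ]
    have := ih.mul hp
    rwa [Nat.cast_succ, add_mul, one_mul]

theorem MinRe.prod {η : ℝ} {ι : Type*} {p : ι → HPoly} (hp : ∀ i, MinRe η (p i)) (d : ι → ℕ)
    (s : Finset ι) : MinRe ((∑ i ∈ s, d i : ℕ) * η) (∏ i ∈ s, p i ^ d i) := by
  classical
  induction s using Finset.induction with
  | empty => simpa using minRe_zero _
  | insert a s ha ih =>
    rw [Finset.prod_insert ha, Finset.sum_insert ha, Nat.cast_add, add_mul]
    exact ((hp a).pow _).mul ih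

/-- Substitution of series in a power series is computed by substitution of their truncations in a
polynomial. -/
theorem agrees_subst {B η : ℝ} {k : ℕ} {g : MvPowerSeries (Fin k) ℂ} {P : MvPolynomial (Fin k) ℂ}
    {Φ : Fin k → ℂ → ℂ} {X : Fin k → HPoly} (hΦ : ∀ i, Agrees B (Φ i) (X i))
    (hX : ∀ i, MinRe η (X i))
    (hP : ∀ d : Fin k →₀ ℕ, d.degree * η ≤ B → P.coeff d = MvPowerSeries.coeff d g) :
    Agrees B (subst g Φ) (MvPolynomial.aeval X P) := by
  have hprod : ∀ d : Fin k →₀ ℕ, Agrees B (prod fun i => pow (Φ i) (d i)) (∏ i, X i ^ d i) :=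
    fun d => Agrees.prod fun i => (hΦ i).pow (d i)
  refine ⟨fun ν hν => ?_, fun κ hκ => ?_⟩
  · refine (finsum_congr fun d => ?_).trans finsum_zero
    rw [(hprod d).1 ν hν, mul_zero]
  · rw [MvPolynomial.aeval_eq_eval₂Hom, MvPolynomial.coe_eval₂Hom, MvPolynomial.eval₂_eq', subst,
      coeff_sum, Finsupp.finsetSum_apply]
    -- Monomials of high degree only have exponents of real part above `B`; for the others the
    -- coefficients of `P` and `g` coincide.
    have hmin : ∀ d : Fin k →₀ ℕ, ¬ d.degree * η ≤ B → (∏ i, X i ^ d i : HPoly).coeff κ = 0 := by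
      intro d hd
      refine MinRe.prod hX d Finset.univ κ (hκ.trans_lt (not_le.1 ?_))
      rwa [← Finsupp.degree_eq_sum]
    have hterm : ∀ d : Fin k →₀ ℕ, MvPowerSeries.coeff d g * prod (fun i => pow (Φ i) (d i)) κ =
        P.coeff d * (∏ i, X i ^ d i : HPoly).coeff κ := by
      intro d
      rw [← (hprod d).2 κ hκ]
      by_cases hd : d.degree * η ≤ B
      · rw [hP d hd]
      · rw [hmin d hd, mul_zero, mul_zero]
    rw [finsum_congr hterm, finsum_eq_sum_of_support_subset (s := P.support)]
    · refine Finset.sum_congr rfl fun d _ => ?_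
      rw [← Algebra.smul_def, coeff_smul, Finsupp.smul_apply, smul_eq_mul]
    · intro d hd
      rw [Function.mem_support] at hd
      exact MvPolynomial.mem_support_iff.2 (left_ne_zero_of_mul hd)

/-- The part of `g` with real parts of the exponents in `[0, B]`. -/
def trunc (B : ℝ) (g : ℂ → ℂ) : HPoly := by
  classical exact
  if h : {κ : halfPlane | (κ : ℂ).re ≤ B ∧ g κ ≠ 0}.Finite then
    .ofCoeff (Finsupp.onFinset h.toFinset (fun κ => if (κ : ℂ).re ≤ B then g κ else 0)
      (by intro κ hκ; simpa using hκ)) else 0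

theorem coeff_trunc {B : ℝ} {g : ℂ → ℂ} (hg : IsGenPowerSeries g) (κ : halfPlane) :
    (trunc B g).coeff κ = if (κ : ℂ).re ≤ B then g κ else 0 := by
  classical
  have h : {κ : halfPlane | (κ : ℂ).re ≤ B ∧ g κ ≠ 0}.Finite :=
    ((hg.2 B).preimage (Subtype.val_injective.injOn (s := _))).subset fun κ hκ => ⟨hκ.2, hκ.1⟩
  rw [trunc, dif_pos h]
  rfl

theorem agrees_trunc {B : ℝ} {g : ℂ → ℂ} (hg : IsGenPowerSeries g) : Agrees B g (trunc B g) := by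
  refine ⟨fun μ hμ => ?_, fun κ hκ => by rw [coeff_trunc hg, if_pos hκ]⟩
  by_contra h
  exact (hg.1 μ h).not_gt hμ

theorem isGenPowerSeries_monom_one : IsGenPowerSeries (monom 1) := by
  have h : ∀ μ : ℂ, monom 1 μ ≠ 0 → μ = 1 := fun μ hμ => by
    by_contra h
    exact hμ (Pi.single_eq_of_ne h _)
  exact ⟨fun μ hμ => by rw [h μ hμ]; simp, fun B => (Set.finite_singleton 1).subset
    fun μ hμ => h μ hμ.1⟩

theorem shift_iterate (ℓ : ℂ) (φ : ℂ → ℂ) (j : ℕ) (μ : ℂ) :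
    (shift ℓ)^[j] φ μ = Complex.exp (μ * ℓ) ^ j * φ μ := by
  induction j with
  | zero => simp
  | succ j ih => rw [Function.iterate_succ_apply', shift, ih, pow_succ']; ring

theorem tuple_succ (n : ℕ) (ℓ : ℂ) (φ : ℂ → ℂ) (j : Fin (n + 1)) (μ : ℂ) :
    tuple n ℓ φ j.succ μ = Complex.exp (μ * ℓ) ^ (j : ℕ) * φ μ := by
  rw [tuple, Fin.cons_succ, shift_iterate]

theorem isGenPowerSeries_tuple {φ : ℂ → ℂ} (hφ : IsGenPowerSeries φ) (n : ℕ) (ℓ : ℂ)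
    (i : Fin (n + 2)) : IsGenPowerSeries (tuple n ℓ φ i) := by
  refine Fin.cases ?_ (fun j => ?_) i
  · exact isGenPowerSeries_monom_one
  · have h : ∀ μ, tuple n ℓ φ j.succ μ ≠ 0 → φ μ ≠ 0 := fun μ hμ => by
      rw [tuple_succ] at hμ
      exact right_ne_zero_of_mul hμ
    exact ⟨fun μ hμ => hφ.1 μ (h μ hμ), fun B => (hφ.2 B).subset fun μ hμ => ⟨h μ hμ.1, hμ.2⟩⟩

theorem exists_pos_le {ι : Type*} {S : Set ι} (hS : S.Finite) {g : ι → ℝ}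
    (hg : ∀ x ∈ S, 0 < g x) : ∃ δ : ℝ, 0 < δ ∧ ∀ x ∈ S, δ ≤ g x := by
  rcases S.eq_empty_or_nonempty with rfl | hne
  · exact ⟨1, one_pos, by simp⟩
  · obtain ⟨a, ha, h⟩ := Set.exists_min_image S g hS hne
    exact ⟨g a, hg a ha, h⟩

/-- A generalized power series has a positive lower bound for the real parts of its exponents. -/
theorem IsGenPowerSeries.exists_le_re {φ : ℂ → ℂ} (hφ : IsGenPowerSeries φ) :
    ∃ η : ℝ, 0 < η ∧ ∀ μ, φ μ ≠ 0 → η ≤ μ.re := by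
  obtain ⟨η, hη, h⟩ := exists_pos_le (hφ.2 1) (g := Complex.re) fun μ hμ => hφ.1 μ hμ.1
  refine ⟨min η 1, lt_min hη one_pos, fun μ hμ => ?_⟩
  rcases le_or_gt μ.re 1 with h1 | h1
  · exact (min_le_left _ _).trans (h μ ⟨hμ, h1⟩)
  · exact (min_le_right _ _).trans h1.le

theorem minRe_trunc {B η : ℝ} {g : ℂ → ℂ} (hg : IsGenPowerSeries g)
    (h : ∀ μ, g μ ≠ 0 → η ≤ μ.re) : MinRe η (trunc B g) := by
  intro κ hκ
  rw [coeff_trunc hg]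
  split_ifs
  · by_contra h'
    exact (h _ h').not_gt hκ
  · rfl

/-- The bound is uniform in `B`. It is what turns a bound on exponents into a bound on the degrees
of the Taylor monomials involved. -/
theorem exists_minRe_tuple {φ : ℂ → ℂ} (hφ : IsGenPowerSeries φ) (n : ℕ) (ℓ : ℂ) :
    ∃ η : ℝ, 0 < η ∧ ∀ B i, MinRe η (trunc B (tuple n ℓ φ i)) := by
  obtain ⟨η, hη, h⟩ := hφ.exists_le_re
  refine ⟨min η 1, lt_min hη one_pos, fun B i => minRe_trunc (isGenPowerSeries_tuple hφ n ℓ i) ?_⟩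
  refine Fin.cases (fun μ hμ => ?_) (fun j μ hμ => ?_) i
  · have : μ = 1 := by
      by_contra h
      exact hμ (Pi.single_eq_of_ne h _)
    rw [this]; simp
  · rw [tuple_succ] at hμ
    exact (min_le_left _ _).trans (h μ (right_ne_zero_of_mul hμ))

/-- The substitution of a tuple in a power series is again a series of the same kind, except that
it may have a constant term. -/
theorem exists_agrees_subst_tuple {φ : ℂ → ℂ} (hφ : IsGenPowerSeries φ) (n : ℕ) (ℓ : ℂ)
    (g : MvPowerSeries (Fin (n + 2)) ℂ) (B : ℝ) :
    ∃ p, Agrees B (subst g (tuple n ℓ φ)) p := by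
  obtain ⟨η, hη, h⟩ := exists_minRe_tuple hφ n ℓ
  obtain ⟨D, hD⟩ := exists_nat_gt (B / η)
  rw [div_lt_iff₀ hη] at hD
  refine ⟨_, agrees_subst (fun i => agrees_trunc (isGenPowerSeries_tuple hφ n ℓ i)) (h B)
    (P := MvPowerSeries.truncTotal D g) fun d hd => MvPowerSeries.coeff_truncTotal g ?_⟩
  exact_mod_cast lt_of_mul_lt_mul_right (hd.trans_lt hD) hη.le

theorem subst_tuple_eq_zero {φ : ℂ → ℂ} (hφ : IsGenPowerSeries φ) {n : ℕ} {ℓ : ℂ}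
    (g : MvPowerSeries (Fin (n + 2)) ℂ) {μ : ℂ} (hμ : μ.re < 0) : subst g (tuple n ℓ φ) μ = 0 := by
  obtain ⟨p, hp⟩ := exists_agrees_subst_tuple hφ n ℓ g 0
  exact hp.1 μ hμ

theorem finite_subst_tuple {φ : ℂ → ℂ} (hφ : IsGenPowerSeries φ) (n : ℕ) (ℓ : ℂ)
    (g : MvPowerSeries (Fin (n + 2)) ℂ) (B : ℝ) :
    {μ : ℂ | subst g (tuple n ℓ φ) μ ≠ 0 ∧ μ.re ≤ B}.Finite := by
  obtain ⟨p, hp⟩ := exists_agrees_subst_tuple hφ n ℓ g B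
  refine (p.coeff.support.finite_toSet.image Subtype.val).subset fun μ hμ => ?_
  have h0 : 0 ≤ μ.re := by
    by_contra h
    exact hμ.1 (hp.1 μ (not_le.1 h))
  refine ⟨⟨μ, h0⟩, ?_, rfl⟩
  rw [Finset.mem_coe, Finsupp.mem_support_iff, hp.2 _ hμ.2]
  exact hμ.1

/-- The chain rule for a derivation. -/
theorem derivation_aeval {R : Type*} [CommRing R] [Algebra ℂ R] {σ : Type*} [Fintype σ]
    (D : Derivation ℂ R R) (V : σ → R) (P : MvPolynomial σ ℂ) :
    D (MvPolynomial.aeval V P) =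
      ∑ i, MvPolynomial.aeval V (MvPolynomial.pderiv i P) * D (V i) := by
  classical
  induction P using MvPolynomial.induction_on with
  | C a => simp
  | add p q hp hq => simp only [map_add, hp, hq, add_mul, Finset.sum_add_distrib]
  | mul_X p j hp =>
    rw [map_mul, Derivation.leibniz, hp, MvPolynomial.aeval_X]
    simp only [Derivation.leibniz, map_add, smul_eq_mul, map_mul, MvPolynomial.aeval_X,
      MvPolynomial.pderiv_X, Pi.single_apply, add_mul, Finset.sum_add_distrib, Finset.mul_sum]
    congr 1
    · rw [Finset.sum_eq_single j]
      · simp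
      · intro i _ hij; simp [hij.symm]
      · simp
    · exact Finset.sum_congr rfl fun i _ => by ring

end

section

open AddMonoidAlgebra

/-! ### Taylor expansion of the equation -/

/-- The polynomial `P (V + Z W)` in the variable `Z`. -/
def expansion {R σ : Type*} [CommRing R] [Algebra ℂ R] (V W : σ → R) (P : MvPolynomial σ ℂ) :
    Polynomial R :=
  MvPolynomial.aeval (fun i => Polynomial.C (V i) + Polynomial.X * Polynomial.C (W i)) P

section expansion

variable {R σ : Type*} [CommRing R] [Algebra ℂ R] (V W : σ → R) (P : MvPolynomial σ ℂ)

theorem eval_expansion (a : R) :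
    (expansion V W P).eval a = MvPolynomial.aeval (fun i => V i + a * W i) P := by
  have h := MvPolynomial.comp_aeval_apply
    (fun i => Polynomial.C (V i) + Polynomial.X * Polynomial.C (W i))
    ((Polynomial.aeval a : Polynomial R →ₐ[R] R).restrictScalars ℂ) P
  simp only [AlgHom.restrictScalars_apply, Polynomial.coe_aeval_eq_eval,
    Polynomial.eval_add, Polynomial.eval_mul, Polynomial.eval_X, Polynomial.eval_C] at h
  exact h

theorem coeff_zero_expansion : (expansion V W P).coeff 0 = MvPolynomial.aeval V P := by
  rw [Polynomial.coeff_zero_eq_eval_zero, eval_expansion]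
  simp

theorem coeff_one_expansion [Fintype σ] : (expansion V W P).coeff 1 =
    ∑ i, MvPolynomial.aeval V (MvPolynomial.pderiv i P) * W i := by
  have h1 : (expansion V W P).coeff 1 = (Polynomial.derivative (expansion V W P)).coeff 0 := by
    simp [Polynomial.coeff_derivative]
  have h2 := derivation_aeval
    ((Polynomial.derivative' : Derivation R (Polynomial R) (Polynomial R)).restrictScalars ℂ)
    (fun i => Polynomial.C (V i) + Polynomial.X * Polynomial.C (W i)) P
  have h3 : Polynomial.derivative (expansion V W P) =
      ∑ i, expansion V W (MvPolynomial.pderiv i P) * Polynomial.C (W i) := by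
    refine Eq.trans h2 (Finset.sum_congr rfl fun i _ => ?_)
    congr 1
    simp [Polynomial.derivative']
  rw [h1, h3, Polynomial.finsetSum_coeff]
  exact Finset.sum_congr rfl fun i _ => by
    rw [Polynomial.coeff_mul_C, coeff_zero_expansion]

theorem aeval_add_mul [Fintype σ] (a : R) : MvPolynomial.aeval (fun i => V i + a * W i) P =
    MvPolynomial.aeval V P + (∑ i, MvPolynomial.aeval V (MvPolynomial.pderiv i P) * W i) * a +
      (expansion V W P).divX.divX.eval a * a * a := by
  set p := expansion V W P with hp
  have h1 := congrArg (Polynomial.eval a) p.divX_mul_X_add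
  have h2 := congrArg (Polynomial.eval a) p.divX.divX_mul_X_add
  simp only [Polynomial.eval_add, Polynomial.eval_mul, Polynomial.eval_X, Polynomial.eval_C,
    Polynomial.coeff_divX] at h1 h2
  rw [← coeff_one_expansion V W P, ← coeff_zero_expansion V W P, ← eval_expansion, ← hp, ← h1, ← h2]
  ring

end expansion

theorem coeff_mul_single_add (p : HPoly) (c : ℂ) (κ s : halfPlane) :
    (p * single s c).coeff (κ + s) = p.coeff κ * c :=
  coeff_mul_single_eq_coeff_mul κ fun a _ => by rw [add_left_inj]

theorem divOf_mul_single {p : HPoly} {s : halfPlane} (hp : MinRe (s : ℂ).re p) :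
    p.divOf s * single s 1 = p := by
  conv_rhs => rw [← divOf_add_modOf p s]
  have : p.modOf s = 0 := by
    ext κ
    by_cases h : ∃ d, κ = s + d
    · exact coeff_modOf_of_exists_add _ _ _ h
    · rw [coeff_modOf_of_not_exists_add _ _ _ h]
      refine hp κ ?_
      by_contra h'
      refine h ⟨⟨κ - s, ?_⟩, Subtype.ext ?_⟩
      · rw [mem_halfPlane, Complex.sub_re]; linarith
      · simp
  rw [this, add_zero, mul_comm]
  rfl

/-- The part of the `i`-th entry of the tuple with exponents in `(N, B]`, divided by `x ^ s`. -/
def tail (n : ℕ) (ℓ : ℂ) (φ : ℂ → ℂ) (N B : ℝ) (s : halfPlane) (i : Fin (n + 2)) : HPoly :=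
  (trunc B (tuple n ℓ φ i) - trunc N (tuple n ℓ φ i)).divOf s

section tail

variable {n : ℕ} {ℓ : ℂ} {φ : ℂ → ℂ} {N B : ℝ} {s : halfPlane}

theorem coeff_tail (hφ : IsGenPowerSeries φ) (hNB : N ≤ B) (i : Fin (n + 2)) (κ : halfPlane) :
    (tail n ℓ φ N B s i).coeff κ = if N < (s + κ : ℂ).re ∧ (s + κ : ℂ).re ≤ B then
      tuple n ℓ φ i (s + κ) else 0 := by
  have hg := isGenPowerSeries_tuple hφ n ℓ i
  rw [tail, coeff_divOf, coeff_sub, Finsupp.sub_apply, coeff_trunc hg, coeff_trunc hg,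
    AddSubmonoid.coe_add]
  by_cases h1 : N < (s + κ : ℂ).re
  · by_cases h2 : (s + κ : ℂ).re ≤ B
    · rw [if_pos h2, if_neg h1.not_ge, if_pos ⟨h1, h2⟩, sub_zero]
    · rw [if_neg h2, if_neg h1.not_ge, if_neg fun h => h2 h.2, sub_zero]
  · rw [if_pos ((not_lt.1 h1).trans hNB), if_pos (not_lt.1 h1), if_neg fun h => h1 h.1, sub_self]

theorem tail_zero (hφ : IsGenPowerSeries φ) (hN : 1 ≤ N) (hNB : N ≤ B) : tail n ℓ φ N B s 0 = 0 := by
  ext κ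
  rw [coeff_tail hφ hNB]
  split_ifs with h
  · refine Pi.single_eq_of_ne (fun h1 => ?_) _
    rw [h1, Complex.one_re] at h
    linarith
  · rfl

theorem trunc_add_tail (hφ : IsGenPowerSeries φ) (hN : (s : ℂ).re ≤ N) (hNB : N ≤ B) (i : Fin (n + 2)) :
    trunc N (tuple n ℓ φ i) + single s 1 * tail n ℓ φ N B s i = trunc B (tuple n ℓ φ i) := by
  have hg := isGenPowerSeries_tuple hφ n ℓ i
  rw [tail, mul_comm, divOf_mul_single, add_sub_cancel]
  intro κ hκ
  rw [coeff_sub, Finsupp.sub_apply, coeff_trunc hg, coeff_trunc hg, if_pos (by linarith),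
    if_pos (by linarith), sub_self]

end tail

/-- Differentiation lowers the degree by one, hence the margin `η` in the hypothesis on `P`. -/
theorem agrees_aeval_pderiv {n : ℕ} {ℓ : ℂ} {φ : ℂ → ℂ} (hφ : IsGenPowerSeries φ)
    {f : MvPowerSeries (Fin (n + 2)) ℂ} {B η : ℝ} (hη : ∀ B i, MinRe η (trunc B (tuple n ℓ φ i)))
    {P : MvPolynomial (Fin (n + 2)) ℂ}
    (hP : ∀ d : Fin (n + 2) →₀ ℕ, d.degree * η ≤ B + η → P.coeff d = MvPowerSeries.coeff d f)
    (i : Fin (n + 2)) : Agrees B (subst (MvPowerSeries.pderiv ℂ i f) (tuple n ℓ φ))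
      (MvPolynomial.aeval (fun i => trunc B (tuple n ℓ φ i)) (MvPolynomial.pderiv i P)) := by
  refine agrees_subst (fun i => agrees_trunc (isGenPowerSeries_tuple hφ n ℓ i)) (hη B)
    fun d hd => ?_
  rw [MvPolynomial.coeff_pderiv, MvPowerSeries.coeff_pderiv, hP]
  rw [map_add, Finsupp.degree_single]
  push_cast
  linarith

/-- The coefficient form of the equation, with the leading linear part isolated. -/
theorem coefficient_identity {n : ℕ} {ℓ : ℂ} {φ : ℂ → ℂ} (hφ : IsGenPowerSeries φ)
    {f : MvPowerSeries (Fin (n + 2)) ℂ} (hsol : ∀ μ, subst f (tuple n ℓ φ) μ = 0)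
    {ν : halfPlane} {A : Fin (n + 1) → ℂ}
    (hA : ∀ j : Fin (n + 1), HasLeadingTerm
      (subst (MvPowerSeries.pderiv ℂ j.succ f) (tuple n ℓ φ)) (A j) ν)
    {δ s : halfPlane} (hδ : 0 < (δ : ℂ).re) (hs : s = ν + δ)
    (hgap : ∀ (j : Fin (n + 1)) (μ : ℂ), μ ≠ ν → μ.re < (s : ℂ).re →
      subst (MvPowerSeries.pderiv ℂ j.succ f) (tuple n ℓ φ) μ = 0)
    {N B η : ℝ} (hN : 1 ≤ N) (hsN : (s : ℂ).re ≤ N) (hNB : N ≤ B)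
    (hη0 : 0 < η) (hη : ∀ B i, MinRe η (trunc B (tuple n ℓ φ i)))
    {P : MvPolynomial (Fin (n + 2)) ℂ}
    (hP : ∀ d : Fin (n + 2) →₀ ℕ, d.degree * η ≤ B + η → P.coeff d = MvPowerSeries.coeff d f)
    {κ : halfPlane} {lam : ℂ} (hlam : lam = κ + δ + s) (hlamN : N < lam.re)
    (hlamB : lam.re + (ν : ℂ).re ≤ B) :
    (charPoly A).eval (Complex.exp (lam * ℓ)) * φ lam =
      -((MvPolynomial.aeval (fun i => trunc N (tuple n ℓ φ i)) P).coeff (κ + s + s) +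
        ∑ j : Fin (n + 1), (((MvPolynomial.aeval (fun i => trunc N (tuple n ℓ φ i))
          (MvPolynomial.pderiv j.succ P)).divOf s) * tail n ℓ φ N B s j.succ).coeff κ +
        ((expansion (fun i => trunc N (tuple n ℓ φ i)) (tail n ℓ φ N B s) P).divX.divX.eval
          (single s 1)).coeff κ) := by
  have hg := isGenPowerSeries_tuple hφ n ℓ
  have hν := ν.2
  rw [mem_halfPlane] at hν
  -- The exponent `κ + 2 s` equals `lam + ν`, which is still within the range where the truncated
  -- substitution is exact, so the equation applies.
  have hzero : (MvPolynomial.aeval (fun i => trunc B (tuple n ℓ φ i)) P).coeff (κ + s + s) = 0 := by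
    have hag := agrees_subst (B := B) (fun i => agrees_trunc (hg i)) (hη B) (g := f) (P := P) ?_
    · rw [hag.2, hsol]
      have : ((κ + s + s : halfPlane) : ℂ) = lam + ν := by
        rw [hlam, hs]; push_cast; ring
      rw [this, Complex.add_re]
      exact hlamB
    · exact fun d hd => hP d (by linarith)
  have hsre : (s : ℂ).re = (ν : ℂ).re + (δ : ℂ).re := by
    rw [hs, AddSubmonoid.coe_add, Complex.add_re]
  set G : Fin (n + 1) → HPoly := fun j => MvPolynomial.aeval (fun i => trunc N (tuple n ℓ φ i))
    (MvPolynomial.pderiv j.succ P) with hGdef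
  -- The gap splits each partial derivative at `V` into its leading monomial and a multiple of `x ^
  -- s`.
  have hG : ∀ j : Fin (n + 1), G j = single ν (A j) + (G j).divOf s * single s 1 := by
    intro j
    have hag := agrees_aeval_pderiv hφ (B := N) hη (fun d hd => hP d (by linarith)) j.succ
    have hmin : MinRe (s : ℂ).re (G j - single ν (A j)) := by
      intro κ hκ
      rw [coeff_sub, Finsupp.sub_apply, hag.2 κ (by linarith), coeff_single]
      by_cases h : κ = ν
      · rw [h, Finsupp.single_eq_same, (hA j).1, sub_self]
      · rw [Finsupp.single_eq_of_ne h, hgap j κ (fun h' => h (Subtype.ext h')) hκ, sub_self]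
    -- Dividing by `x ^ s` discards the leading monomial, because `re ν < re s`.
    have hdiv : (G j - single ν (A j)).divOf s = (G j).divOf s := by
      ext κ
      rw [coeff_divOf, coeff_divOf, coeff_sub, Finsupp.sub_apply, coeff_single,
        Finsupp.single_eq_of_ne, sub_zero]
      intro h
      have h1 := congrArg (fun z : halfPlane => (z : ℂ).re) h
      have h2 := re_nonneg κ
      simp only [AddSubmonoid.coe_add, Complex.add_re] at h1
      linarith
    rw [← hdiv, divOf_mul_single hmin]
    abel
  have hexp := aeval_add_mul (fun i => trunc N (tuple n ℓ φ i)) (tail n ℓ φ N B s) P (single s 1)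
  simp only [trunc_add_tail hφ hsN hNB] at hexp
  rw [hexp, coeff_add, coeff_add, Finsupp.add_apply, Finsupp.add_apply, coeff_mul_single_add,
    coeff_mul_single_add, coeff_mul_single_add, Fin.sum_univ_succ, tail_zero hφ hN hNB, mul_zero,
    zero_add, mul_one, mul_one, mul_one, coeff_sum, Finsupp.finsetSum_apply] at hzero
  -- The leading monomial picks out the coefficient of `W` at `κ + δ`, that is, of `σ^j φ` at `lam`.
  -- Everything else is evaluated at `κ`, lower by `δ`.
  have hlin : ∀ j : Fin (n + 1), (G j * tail n ℓ φ N B s j.succ).coeff (κ + s) =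
      A j * Complex.exp (lam * ℓ) ^ (j : ℕ) * φ lam +
        ((G j).divOf s * tail n ℓ φ N B s j.succ).coeff κ := by
    intro j
    conv_lhs => rw [hG j]
    have e1 : (single ν (A j) + (G j).divOf s * single s 1) * tail n ℓ φ N B s j.succ =
        tail n ℓ φ N B s j.succ * single ν (A j) +
          (G j).divOf s * tail n ℓ φ N B s j.succ * single s 1 := by ring
    have e2 : κ + s = κ + δ + ν := by rw [hs]; abel
    have e3 : ((s : ℂ) + (κ + δ : halfPlane)) = lam := by rw [hlam]; push_cast; ring
    rw [e1, coeff_add, Finsupp.add_apply, coeff_mul_single_add, mul_one, e2, coeff_mul_single_add,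
      coeff_tail hφ hNB, e3, if_pos ⟨hlamN, by linarith⟩, tuple_succ]
    ring
  have hL : (charPoly A).eval (Complex.exp (lam * ℓ)) * φ lam =
      ∑ j : Fin (n + 1), A j * Complex.exp (lam * ℓ) ^ (j : ℕ) * φ lam := by
    rw [charPoly, Polynomial.eval_finsetSum, Finset.sum_mul]
    simp
  rw [Finset.sum_congr rfl fun j _ => hlin j, Finset.sum_add_distrib, ← hL] at hzero
  linear_combination hzero

end

section

open AddMonoidAlgebra NNReal

/-! ### Estimates for the coefficients -/

/-- The function `r ^ t e ^ (-h t)`. -/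
def damping (r : ℝ) (h : ℝ → ℝ) (t : ℝ) : ℝ≥0 := Real.toNNReal (r ^ t * Real.exp (-h t))

/-- The weight `r ^ t e ^ (-h t)`, where `t` is the real part of the exponent, cut off at `c`. -/
def weight (r : ℝ) (h : ℝ → ℝ) (c : ℝ) (κ : halfPlane) : ℝ≥0 :=
  if (κ : ℂ).re ≤ c then damping r h (κ : ℂ).re else 0

/-- The weight `r ^ t`, where `t` is the real part of the exponent. -/
def powWeight (r : ℝ) (κ : halfPlane) : ℝ≥0 := Real.toNNReal (r ^ (κ : ℂ).re)

theorem coe_damping {r : ℝ} (hr : 0 ≤ r) (h : ℝ → ℝ) (t : ℝ) :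
    (damping r h t : ℝ) = r ^ t * Real.exp (-h t) :=
  Real.coe_toNNReal _ (by positivity)

theorem coe_powWeight {r : ℝ} (hr : 0 ≤ r) (κ : halfPlane) :
    (powWeight r κ : ℝ) = r ^ (κ : ℂ).re :=
  Real.coe_toNNReal _ (by positivity)

/-- Superadditivity of `h` is submultiplicativity of `e ^ (-h)`. The cutoff does no harm: if a sum
of non-negative real parts is at most `c`, so is each summand. -/
theorem isAlgNorm_weight {r : ℝ} (hr : 0 < r) {h : ℝ → ℝ} (hh : IsPotential h) (c : ℝ) :
    IsAlgNorm (wnorm (weight r h c)) := by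
  refine isAlgNorm_wnorm ?_ fun a b => ?_
  · rw [weight]
    split_ifs
    · rw [← NNReal.coe_le_coe, coe_damping hr.le]
      simpa using hh.nonneg 0 le_rfl
    · exact zero_le
  · have ha := re_nonneg a
    have hb := re_nonneg b
    simp only [weight, AddSubmonoid.coe_add, Complex.add_re]
    by_cases hab : (a : ℂ).re + (b : ℂ).re ≤ c
    · rw [if_pos hab, if_pos (by linarith), if_pos (by linarith), ← NNReal.coe_le_coe,
        NNReal.coe_mul, coe_damping hr.le, coe_damping hr.le, coe_damping hr.le, Real.rpow_add hr,
        mul_mul_mul_comm, ← Real.exp_add]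
      gcongr
      have := hh.add_le _ _ ha hb
      linarith
    · rw [if_neg hab]; exact zero_le

theorem isAlgNorm_powWeight {r : ℝ} (hr : 0 < r) : IsAlgNorm (wnorm (powWeight r)) := by
  refine isAlgNorm_wnorm ?_ fun a b => ?_
  · rw [← NNReal.coe_le_coe, coe_powWeight hr.le]
    simp
  · rw [← NNReal.coe_le_coe, NNReal.coe_mul, coe_powWeight hr.le, coe_powWeight hr.le,
      coe_powWeight hr.le, AddSubmonoid.coe_add, Complex.add_re, Real.rpow_add hr]

/-- Lets the contributions of the truncation be bounded at a fixed radius `r₀`, by constants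
independent of `r`, `h` and `c`. -/
theorem weight_le_powWeight {r r₀ : ℝ} (hr : 0 < r) (hrr : r ≤ r₀) {h : ℝ → ℝ}
    (hh : IsPotential h) (c : ℝ) (κ : halfPlane) : weight r h c κ ≤ powWeight r₀ κ := by
  rw [weight]
  split_ifs
  · rw [← NNReal.coe_le_coe, coe_damping hr.le, coe_powWeight (hr.trans_le hrr).le]
    have h1 := re_nonneg κ
    have h2 : Real.exp (-h (κ : ℂ).re) ≤ 1 := by simpa using hh.nonneg _ h1
    exact (mul_le_of_le_one_right (by positivity) h2).trans (by gcongr)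
  · exact zero_le

theorem weight_le_one {r : ℝ} (hr : 0 < r) (hr1 : r ≤ 1) {h : ℝ → ℝ}
    (hh : IsPotential h) (c : ℝ) (κ : halfPlane) : weight r h c κ ≤ 1 := by
  refine (weight_le_powWeight hr hr1 hh c κ).trans ?_
  rw [← NNReal.coe_le_coe, coe_powWeight zero_le_one]
  simp

/-- Division by a monomial is bounded in the weighted norms. -/
theorem wnorm_weight_divOf_le {r r₀ : ℝ} (hr : 0 < r) (hrr : r ≤ r₀) {h : ℝ → ℝ}
    (hh : IsPotential h) (c : ℝ) (s : halfPlane) (p : HPoly) :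
    wnorm (weight r h c) (p.divOf s) ≤
      Real.toNNReal (r₀ ^ (-(s : ℂ).re)) * wnorm (powWeight r₀) p := by
  have hr₀ := hr.trans_le hrr
  refine wnorm_divOf_le s (fun a => (weight_le_powWeight hr hrr hh c a).trans (le_of_eq ?_)) p
  rw [← NNReal.coe_inj, NNReal.coe_mul, coe_powWeight hr₀.le, coe_powWeight hr₀.le,
    Real.coe_toNNReal _ (by positivity), AddSubmonoid.coe_add, Complex.add_re, Real.rpow_add hr₀,
    ← mul_assoc, ← Real.rpow_add hr₀, neg_add_cancel, Real.rpow_zero, one_mul]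

/-- For `η > 0` this makes a fixed truncation as small as desired by shrinking `r`. -/
theorem wnorm_powWeight_le {r η : ℝ} (hr : 0 < r) (hr1 : r ≤ 1) {p : HPoly} (hp : MinRe η p) :
    wnorm (powWeight r) p ≤ Real.toNNReal (r ^ η) * wnorm (fun _ => 1) p := by
  rw [wnorm, wnorm, Finsupp.mul_sum]
  refine Finset.sum_le_sum fun κ hκ => ?_
  simp only [mul_one]
  rw [mul_comm]
  gcongr
  refine Real.toNNReal_le_toNNReal (Real.rpow_le_rpow_of_exponent_ge hr hr1 ?_)
  by_contra h
  exact Finsupp.mem_support_iff.1 hκ (hp κ (not_le.1 h))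

/-- A finite set of exponents of a generalized power series. -/
def expFinset {φ : ℂ → ℂ} (hφ : IsGenPowerSeries φ) (N B : ℝ) : Finset ℂ :=
  Set.Finite.toFinset (s := {μ | φ μ ≠ 0 ∧ N < μ.re ∧ μ.re ≤ B})
    ((hφ.2 B).subset fun _ h => ⟨h.1, h.2.2⟩)

theorem mem_expFinset {φ : ℂ → ℂ} {hφ : IsGenPowerSeries φ} {N B : ℝ} {μ : ℂ} :
    μ ∈ expFinset hφ N B ↔ φ μ ≠ 0 ∧ N < μ.re ∧ μ.re ≤ B := by
  rw [expFinset, Set.Finite.mem_toFinset]; rfl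

/-- The sum of the moduli `|z| ^ j`, `j = 0, …, n`. -/
def powSum (n : ℕ) (z : ℂ) : ℝ≥0 := ∑ j : Fin (n + 1), ‖z‖₊ ^ (j : ℕ)

/-- The weighted sum of the moduli of the coefficients with exponents in `(N, B]`. -/
def partialSum {φ : ℂ → ℂ} (hφ : IsGenPowerSeries φ) (n : ℕ) (ℓ : ℂ) (r : ℝ) (h : ℝ → ℝ)
    (s N B : ℝ) : ℝ≥0 :=
  ∑ μ ∈ expFinset hφ N B, ‖φ μ‖₊ * powSum n (Complex.exp (μ * ℓ)) * damping r h (μ.re - s)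

/-- The cutoff of the weight, and not `B`, decides which coefficients of `φ` enter. This makes the
recursion triangular. -/
theorem wnorm_tail_le {n : ℕ} {ℓ : ℂ} {φ : ℂ → ℂ} (hφ : IsGenPowerSeries φ) {N B c r : ℝ}
    {h : ℝ → ℝ} {s : halfPlane} (hNB : N ≤ B) (j : Fin (n + 1)) :
    wnorm (weight r h c) (tail n ℓ φ N B s j.succ) ≤
      partialSum hφ n ℓ r h (s : ℂ).re N (c + (s : ℂ).re) := by
  classical
  set T := (tail n ℓ φ N B s j.succ).coeff.support.filter fun κ : halfPlane => (κ : ℂ).re ≤ c with hT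
  have e : wnorm (weight r h c) (tail n ℓ φ N B s j.succ) =
      ∑ κ ∈ T, ‖(tail n ℓ φ N B s j.succ).coeff κ‖₊ * damping r h (κ : ℂ).re := by
    rw [hT, Finset.sum_filter, wnorm]
    refine Finset.sum_congr rfl fun κ _ => ?_
    simp only [weight]
    split_ifs <;> simp
  have hinj : Set.InjOn (fun κ : halfPlane => (s + κ : ℂ)) T := fun a _ b _ hab =>
    Subtype.ext (add_left_cancel hab)
  have hmem : ∀ κ ∈ T, (N < (s + κ : ℂ).re ∧ (s + κ : ℂ).re ≤ B) ∧ φ (s + κ) ≠ 0 := by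
    intro κ hκ
    have h1 := Finsupp.mem_support_iff.1 (Finset.mem_filter.1 hκ).1
    rw [coeff_tail hφ hNB] at h1
    by_cases h2 : N < (s + κ : ℂ).re ∧ (s + κ : ℂ).re ≤ B
    · rw [if_pos h2, tuple_succ] at h1
      exact ⟨h2, right_ne_zero_of_mul h1⟩
    · exact absurd (if_neg h2) h1
  calc wnorm (weight r h c) (tail n ℓ φ N B s j.succ)
      ≤ ∑ κ ∈ T, ‖φ (s + κ)‖₊ * powSum n (Complex.exp ((s + κ) * ℓ)) *
          damping r h ((s + κ : ℂ).re - (s : ℂ).re) := by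
        rw [e]
        refine Finset.sum_le_sum fun κ hκ => ?_
        rw [coeff_tail hφ hNB, if_pos (hmem κ hκ).1, tuple_succ, nnnorm_mul, nnnorm_pow,
          Complex.add_re, add_sub_cancel_left, mul_comm (_ ^ _)]
        gcongr
        exact Finset.single_le_sum (f := fun j : Fin (n + 1) => _ ^ (j : ℕ))
          (fun _ _ => zero_le) (Finset.mem_univ j)
    _ = ∑ μ ∈ T.image fun κ : halfPlane => (s + κ : ℂ), ‖φ μ‖₊ * powSum n (Complex.exp (μ * ℓ)) *
          damping r h (μ.re - (s : ℂ).re) := (Finset.sum_image (f := fun μ : ℂ => ‖φ μ‖₊ *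
          powSum n (Complex.exp (μ * ℓ)) * damping r h (μ.re - (s : ℂ).re)) hinj).symm
    _ ≤ _ := by
        refine Finset.sum_le_sum_of_subset fun μ hμ => ?_
        obtain ⟨κ, hκ, rfl⟩ := Finset.mem_image.1 hμ
        refine mem_expFinset.2 ⟨(hmem κ hκ).2, (hmem κ hκ).1.1, ?_⟩
        have := (Finset.mem_filter.1 hκ).2
        rw [Complex.add_re]
        linarith

/-- The recursive estimate of the weighted sums of coefficients. -/
theorem partialSum_le {n : ℕ} {ℓ : ℂ} {φ : ℂ → ℂ} (hφ : IsGenPowerSeries φ)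
    {f : MvPowerSeries (Fin (n + 2)) ℂ} (hsol : ∀ μ, subst f (tuple n ℓ φ) μ = 0)
    {ν : halfPlane} {A : Fin (n + 1) → ℂ}
    (hA : ∀ j : Fin (n + 1), HasLeadingTerm
      (subst (MvPowerSeries.pderiv ℂ j.succ f) (tuple n ℓ φ)) (A j) ν)
    {δ s : halfPlane} (hδ : 0 < (δ : ℂ).re) (hs : s = ν + δ)
    (hgap : ∀ (j : Fin (n + 1)) (μ : ℂ), μ ≠ ν → μ.re < (s : ℂ).re →
      subst (MvPowerSeries.pderiv ℂ j.succ f) (tuple n ℓ φ) μ = 0)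
    {N c B η : ℝ} (hN : 1 ≤ N) (hsN : (s : ℂ).re + (δ : ℂ).re ≤ N) (hNB : N ≤ B)
    (hcB : c + (s : ℂ).re + (s : ℂ).re ≤ B)
    (hη0 : 0 < η) (hη : ∀ B i, MinRe η (trunc B (tuple n ℓ φ i)))
    {P : MvPolynomial (Fin (n + 2)) ℂ}
    (hP : ∀ d : Fin (n + 2) →₀ ℕ, d.degree * η ≤ B + η → P.coeff d = MvPowerSeries.coeff d f)
    {r C : ℝ} (hr : 0 < r) (hC : 0 ≤ C) {h : ℝ → ℝ}
    (hpot : ∀ lam : ℂ, φ lam ≠ 0 → N < lam.re → ∀ t, 0 ≤ t → t < lam.re - (s : ℂ).re →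
      ∀ j : Fin (n + 1), ‖Complex.exp (lam * ℓ)‖ ^ (j : ℕ) * Real.exp (h t) ≤
        C * ‖(charPoly A).eval (Complex.exp (lam * ℓ))‖ * Real.exp (h (lam.re - (s : ℂ).re))) :
    partialSum hφ n ℓ r h (s : ℂ).re N (c + (s : ℂ).re + (δ : ℂ).re) ≤
      Real.toNNReal ((n + 1) * C * r ^ (δ : ℂ).re) *
        (wnorm (weight r h c) ((MvPolynomial.aeval (fun i => trunc N (tuple n ℓ φ i)) P).divOf
            (s + s)) +
          ∑ j : Fin (n + 1), wnorm (weight r h c)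
            (((MvPolynomial.aeval (fun i => trunc N (tuple n ℓ φ i))
              (MvPolynomial.pderiv j.succ P)).divOf s) * tail n ℓ φ N B s j.succ) +
          wnorm (weight r h c) ((expansion (fun i => trunc N (tuple n ℓ φ i))
            (tail n ℓ φ N B s) P).divX.divX.eval (single s 1))) := by
  classical
  set p₀ := (MvPolynomial.aeval (fun i => trunc N (tuple n ℓ φ i)) P).divOf (s + s) with hp₀
  set p₁ : Fin (n + 1) → HPoly := fun j => ((MvPolynomial.aeval
    (fun i => trunc N (tuple n ℓ φ i)) (MvPolynomial.pderiv j.succ P)).divOf s) *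
      tail n ℓ φ N B s j.succ with hp₁
  set p₂ := (expansion (fun i => trunc N (tuple n ℓ φ i))
    (tail n ℓ φ N B s) P).divX.divX.eval (single s 1) with hp₂
  set E := expFinset hφ N (c + (s : ℂ).re + (δ : ℂ).re) with hE
  -- The shift from `lam` to the `κ` of `coefficient_identity`. It stays in the half-plane because
  -- `μ.re > N ≥ re s + re δ`, and `k μ` is below the cutoff `c` exactly when `μ.re ≤ c + re s + re
  -- δ`.
  set k : ℂ → halfPlane := fun μ => if h : 0 ≤ (μ - δ - s).re then ⟨μ - δ - s, h⟩ else 0 with hk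
  have hkE : ∀ μ ∈ E, (k μ : ℂ) = μ - δ - s := by
    intro μ hμ
    have h1 := (mem_expFinset.1 hμ).2.1
    have : 0 ≤ (μ - δ - s).re := by
      rw [Complex.sub_re, Complex.sub_re]; linarith
    simp only [hk, dif_pos this]
  have hinj : Set.InjOn k E := by
    intro a ha b hb hab
    have := congrArg (Subtype.val) hab
    rw [hkE a ha, hkE b hb] at this
    simpa using this
  have hsre : (s : ℂ).re = (ν : ℂ).re + (δ : ℂ).re := by
    rw [hs, AddSubmonoid.coe_add, Complex.add_re]
  have hterm : ∀ μ ∈ E,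
      ‖φ μ‖₊ * powSum n (Complex.exp (μ * ℓ)) * damping r h (μ.re - (s : ℂ).re) ≤
        Real.toNNReal ((n + 1) * C * r ^ (δ : ℂ).re) *
          (‖p₀.coeff (k μ)‖₊ * weight r h c (k μ) +
            ∑ j, ‖(p₁ j).coeff (k μ)‖₊ * weight r h c (k μ) +
            ‖p₂.coeff (k μ)‖₊ * weight r h c (k μ)) := by
    intro μ hμ
    obtain ⟨hμ0, hμN, hμB⟩ := mem_expFinset.1 hμ
    have hkμ := hkE μ hμ
    have hkre : (k μ : ℂ).re = μ.re - (s : ℂ).re - (δ : ℂ).re := by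
      rw [hkμ, Complex.sub_re, Complex.sub_re]; ring
    have hid := coefficient_identity hφ hsol hA hδ hs hgap hN (by linarith) hNB hη0 hη hP
      (κ := k μ) (lam := μ) (by rw [hkμ]; ring) hμN (by linarith)
    have hle : ‖(charPoly A).eval (Complex.exp (μ * ℓ))‖₊ * ‖φ μ‖₊ ≤
        ‖p₀.coeff (k μ)‖₊ + ∑ j, ‖(p₁ j).coeff (k μ)‖₊ + ‖p₂.coeff (k μ)‖₊ := by
      rw [← nnnorm_mul, hid, nnnorm_neg]
      refine (nnnorm_add_le _ _).trans ?_
      gcongr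
      refine (nnnorm_add_le _ _).trans ?_
      gcongr
      · rw [hp₀, coeff_divOf, add_comm (s + s), add_assoc]
      · exact nnnorm_sum_le _ _
    have hw : weight r h c (k μ) = damping r h (k μ : ℂ).re := if_pos (by linarith)
    calc ‖φ μ‖₊ * powSum n (Complex.exp (μ * ℓ)) * damping r h (μ.re - (s : ℂ).re)
        ≤ Real.toNNReal ((n + 1) * C * r ^ (δ : ℂ).re) *
          ((‖(charPoly A).eval (Complex.exp (μ * ℓ))‖₊ * ‖φ μ‖₊) * weight r h c (k μ)) := by
          -- The potential is used at `t = re (k μ)`, which lies `re δ` below `μ.re - re s`. Summing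
          -- over `j` gives the factor `n + 1`.
          have hpot' : (powSum n (Complex.exp (μ * ℓ)) : ℝ) * Real.exp (h (k μ : ℂ).re) ≤
              (n + 1) * (C * ‖(charPoly A).eval (Complex.exp (μ * ℓ))‖ *
                Real.exp (h (μ.re - (s : ℂ).re))) := by
            rw [powSum, NNReal.coe_sum, Finset.sum_mul]
            refine (Finset.sum_le_card_nsmul _ _ (C * ‖(charPoly A).eval (Complex.exp (μ * ℓ))‖ *
                Real.exp (h (μ.re - (s : ℂ).re))) fun j _ => ?_).trans (le_of_eq ?_)
            · exact hpot μ hμ0 hμN _ (re_nonneg _) (by linarith) j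
            · simp
          rw [hw, ← NNReal.coe_le_coe]
          push_cast
          rw [coe_damping hr.le, coe_damping hr.le, Real.coe_toNNReal _ (by positivity), Real.exp_neg,
            Real.exp_neg, show μ.re - (s : ℂ).re = (δ : ℂ).re + (k μ : ℂ).re by linarith,
            Real.rpow_add hr]
          rw [show μ.re - (s : ℂ).re = (δ : ℂ).re + (k μ : ℂ).re by linarith] at hpot'
          have h1 : (powSum n (Complex.exp (μ * ℓ)) : ℝ) *
              (Real.exp (h ((δ : ℂ).re + (k μ : ℂ).re)))⁻¹ ≤
              (n + 1) * (C * ‖(charPoly A).eval (Complex.exp (μ * ℓ))‖) *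
                (Real.exp (h (k μ : ℂ).re))⁻¹ := by
            rw [← div_eq_mul_inv, ← div_eq_mul_inv, div_le_div_iff₀ (Real.exp_pos _)
              (Real.exp_pos _)]
            linarith
          calc _ = (‖φ μ‖ * r ^ (δ : ℂ).re * r ^ (k μ : ℂ).re) *
                ((powSum n (Complex.exp (μ * ℓ)) : ℝ) *
                  (Real.exp (h ((δ : ℂ).re + (k μ : ℂ).re)))⁻¹) := by
                ring
            _ ≤ (‖φ μ‖ * r ^ (δ : ℂ).re * r ^ (k μ : ℂ).re) * ((n + 1) *
                (C * ‖(charPoly A).eval (Complex.exp (μ * ℓ))‖) *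
                (Real.exp (h (k μ : ℂ).re))⁻¹) := by gcongr
            _ = _ := by ring
      _ ≤ Real.toNNReal ((n + 1) * C * r ^ (δ : ℂ).re) *
          ((‖p₀.coeff (k μ)‖₊ + ∑ j, ‖(p₁ j).coeff (k μ)‖₊ + ‖p₂.coeff (k μ)‖₊) *
            weight r h c (k μ)) := by gcongr
      _ = _ := by simp only [add_mul _ _ (weight r h c (k μ)), Finset.sum_mul]
  have hsum : ∀ p : HPoly, ∑ μ ∈ E, ‖p.coeff (k μ)‖₊ * weight r h c (k μ) ≤
      wnorm (weight r h c) p := by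
    intro p
    rw [← Finset.sum_image (f := fun κ => ‖p.coeff κ‖₊ * weight r h c κ) hinj]
    exact sum_le_wnorm p _
  refine (Finset.sum_le_sum hterm).trans ?_
  rw [← Finset.mul_sum, Finset.sum_add_distrib, Finset.sum_add_distrib, Finset.sum_comm]
  gcongr
  · exact hsum p₀
  · exact hsum (p₁ _)
  · exact hsum p₂

end

section

open AddMonoidAlgebra NNReal

/-! ### Convergence under a bound for the small divisors -/

/-- Evaluation at the point with all coordinates `r / 2`; summability in `ℂ` is absolute. -/
theorem HasTaylorSeries.exists_summable {k : ℕ} {F : (Fin k → ℂ) → ℂ}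
    {f : MvPowerSeries (Fin k) ℂ} (hF : HasTaylorSeries F f) :
    ∃ b : ℝ≥0, 0 < b ∧
      Summable fun d : Fin k →₀ ℕ => ‖MvPowerSeries.coeff d f‖₊ * ∏ i, b ^ d i := by
  obtain ⟨r, hr, h⟩ := hF
  obtain ⟨b, hb⟩ : ∃ b : ℝ≥0, (b : ℝ) = r / 2 := ⟨_, Real.coe_toNNReal _ (half_pos hr).le⟩
  refine ⟨b, NNReal.coe_pos.1 (hb ▸ half_pos hr), ?_⟩
  have h1 := (h (fun _ => ((b : ℝ) : ℂ)) fun _ => by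
    rw [Complex.norm_real, NNReal.norm_eq, hb]; linarith).summable.norm
  rw [← NNReal.summable_coe]
  refine h1.congr fun d => ?_
  simp

/-- Only finitely many exponents have real part at most `re ν + 1`, so those beyond `re ν` stay away
from it by a definite amount. -/
theorem exists_gap {n : ℕ} {ℓ : ℂ} {φ : ℂ → ℂ} (hφ : IsGenPowerSeries φ)
    {f : MvPowerSeries (Fin (n + 2)) ℂ} {ν : ℂ} {A : Fin (n + 1) → ℂ}
    (hA : ∀ j : Fin (n + 1), HasLeadingTerm
      (subst (MvPowerSeries.pderiv ℂ j.succ f) (tuple n ℓ φ)) (A j) ν) :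
    ∃ δ : ℝ, 0 < δ ∧ ∀ (j : Fin (n + 1)) (μ : ℂ), μ ≠ ν → μ.re < ν.re + δ →
      subst (MvPowerSeries.pderiv ℂ j.succ f) (tuple n ℓ φ) μ = 0 := by
  have hfin := Set.finite_iUnion fun j : Fin (n + 1) => (finite_subst_tuple hφ n ℓ
    (MvPowerSeries.pderiv ℂ j.succ f) (ν.re + 1)).inter_of_left {μ | ν.re < μ.re}
  obtain ⟨δ, hδ, h⟩ := exists_pos_le hfin (g := fun μ => μ.re - ν.re) fun μ hμ => by
    obtain ⟨j, hj⟩ := Set.mem_iUnion.1 hμ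
    exact sub_pos.2 hj.2
  refine ⟨min δ 1, lt_min hδ one_pos, fun j μ hμ hre => ?_⟩
  by_contra hne
  have h1 : ν.re < μ.re := by
    by_contra h'
    exact hne ((hA j).2 μ hμ (not_lt.1 h'))
  have h2 := h μ (Set.mem_iUnion.2 ⟨j, ⟨hne, by linarith [min_le_right δ 1]⟩, h1⟩)
  linarith [min_le_left δ 1]

theorem exists_rpow_le {K ε δ r₀ : ℝ} (hε : 0 < ε) (hδ : 0 < δ) (hr₀ : 0 < r₀) :
    ∃ r, 0 < r ∧ r ≤ r₀ ∧ K * r ^ δ ≤ ε := by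
  have h0 : 0 < ε / (|K| + 1) := by positivity
  refine ⟨min r₀ ((ε / (|K| + 1)) ^ δ⁻¹), lt_min hr₀ (by positivity), min_le_left _ _, ?_⟩
  have h1 : min r₀ ((ε / (|K| + 1)) ^ δ⁻¹) ^ δ ≤ ε / (|K| + 1) := by
    calc _ ≤ ((ε / (|K| + 1)) ^ δ⁻¹) ^ δ := by
          gcongr
          exact min_le_right _ _
      _ = _ := by rw [← Real.rpow_mul h0.le, inv_mul_cancel₀ hδ.ne', Real.rpow_one]
  calc _ ≤ |K| * (ε / (|K| + 1)) := by
        refine mul_le_mul (le_abs_self K) h1 (by positivity) (abs_nonneg K)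
    _ ≤ ε := by
        rw [mul_div_assoc', div_le_iff₀ (by positivity)]
        nlinarith [abs_nonneg K]

theorem polyNorm_linear_le {R : Type*} [CommRing R] [Algebra ℂ R] {N : R → ℝ≥0} (hN : IsAlgNorm N)
    (v w : R) : polyNorm N (Polynomial.C v + Polynomial.X * Polynomial.C w) ≤ N v + N w := by
  refine (polyNorm_add_le hN _ _).trans (le_of_eq ?_)
  rw [polyNorm_C hN, mul_comm, ← pow_one (Polynomial.X : Polynomial R),
    Polynomial.C_mul_X_pow_eq_monomial, polyNorm_monomial hN]

section bounds

variable {R σ : Type*} [CommRing R] [Algebra ℂ R] {N : R → ℝ≥0} [Fintype σ]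
  {V W : σ → R} {P : MvPolynomial σ ℂ} {c : (σ →₀ ℕ) → ℝ≥0} {b : ℝ≥0}

theorem polyNorm_expansion_le (hN : IsAlgNorm N) (hVW : ∀ i, N (V i) + N (W i) ≤ b)
    (hP : ∀ d, ‖MvPolynomial.coeff d P‖₊ ≤ c d)
    (hc : Summable fun d : σ →₀ ℕ => c d * ∏ i, b ^ d i) :
    polyNorm N (expansion V W P) ≤ ∑' d : σ →₀ ℕ, c d * ∏ i, b ^ d i :=
  (isAlgNorm_polyNorm hN).aeval_le_tsum _ P
    (fun i => (polyNorm_linear_le hN _ _).trans (hVW i)) hP hc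

/-- Cauchy's estimate for the partial derivatives. -/
theorem norm_aeval_pderiv_le (hN : IsAlgNorm N) (hb : 0 < b) (hV : ∀ i, N (V i) ≤ b / 2)
    (hP : ∀ d, ‖MvPolynomial.coeff d P‖₊ ≤ c d)
    (hc : Summable fun d : σ →₀ ℕ => c d * ∏ i, b ^ d i) (i : σ) :
    N (MvPolynomial.aeval V (MvPolynomial.pderiv i P)) ≤
      (b / 2)⁻¹ * ∑' d : σ →₀ ℕ, c d * ∏ i, b ^ d i := by
  classical
  set β : ℂ := (((b / 2 : ℝ≥0) : ℝ) : ℂ) with hβ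
  have hβn : ‖β‖₊ = b / 2 := by
    rw [← NNReal.coe_inj, coe_nnnorm, hβ, Complex.norm_real, Real.norm_of_nonneg (by positivity)]
  have hβ0 : β ≠ 0 := by
    rw [← nnnorm_ne_zero_iff, hβn]
    exact (half_pos hb).ne'
  -- Expand `P (V + Z β e_i)` with `β = b / 2`: its linear coefficient is `β` times the partial
  -- derivative.
  have h1 := polyNorm_expansion_le (W := Pi.single i (algebraMap ℂ R β)) hN (fun k => by
    have h2 : N ((Pi.single i (algebraMap ℂ R β) : σ → R) k) ≤ b / 2 := by
      rw [Pi.single_apply]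
      split_ifs
      · exact (hN.algebraMap_le β).trans hβn.le
      · rw [hN.zero]; exact zero_le
    exact (add_le_add (hV k) h2).trans (add_halves b).le) hP hc
  have h3 := (le_polyNorm hN _ 1).trans h1
  rw [coeff_one_expansion, Finset.sum_eq_single i (fun k _ hk => by
    rw [Pi.single_eq_of_ne hk, mul_zero]) (by simp), Pi.single_eq_same] at h3
  set x := MvPolynomial.aeval V (MvPolynomial.pderiv i P)
  have h4 : x = algebraMap ℂ R β⁻¹ * (x * algebraMap ℂ R β) := by
    rw [mul_left_comm, ← map_mul, inv_mul_cancel₀ hβ0, map_one, mul_one]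
  rw [h4]
  refine (hN.mul_le _ _).trans (mul_le_mul' ((hN.algebraMap_le _).trans ?_) h3)
  rw [nnnorm_inv, hβn]

end bounds

/-- A generalized power series solution converges if there is a potential for the divisors. -/
theorem summable_of_potential {n : ℕ} {ℓ : ℂ} {F : (Fin (n + 2) → ℂ) → ℂ}
    {f : MvPowerSeries (Fin (n + 2)) ℂ} (hF : HasTaylorSeries F f)
    {φ : ℂ → ℂ} (hφ : IsGenPowerSeries φ) (hsol : ∀ μ, subst f (tuple n ℓ φ) μ = 0)
    {ν : ℂ} {A : Fin (n + 1) → ℂ}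
    (hA : ∀ j : Fin (n + 1), HasLeadingTerm
      (subst (MvPowerSeries.pderiv ℂ j.succ f) (tuple n ℓ φ)) (A j) ν)
    (hA₀ : ∃ j, A j ≠ 0)
    (hpot : ∀ s : ℝ, 0 ≤ s → ∃ h, IsPotential h ∧ ∃ C N : ℝ, 0 < C ∧
      ∀ lam : ℂ, φ lam ≠ 0 → N < lam.re → ∀ t, 0 ≤ t → t < lam.re - s → ∀ j : Fin (n + 1),
        ‖Complex.exp (lam * ℓ)‖ ^ (j : ℕ) * Real.exp (h t) ≤
          C * ‖(charPoly A).eval (Complex.exp (lam * ℓ))‖ * Real.exp (h (lam.re - s))) :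
    ∃ r : ℝ, 0 < r ∧ Summable fun μ : ℂ => ‖φ μ‖ * r ^ μ.re := by
  classical
  obtain ⟨η, hη0, hη⟩ := exists_minRe_tuple hφ n ℓ
  obtain ⟨b, hb, hsum⟩ := hF.exists_summable
  obtain ⟨δ, hδ, hgap⟩ := exists_gap hφ hA
  have hν : 0 ≤ ν.re := by
    obtain ⟨j, hj⟩ := hA₀
    by_contra h
    exact hj ((hA j).1 ▸ subst_tuple_eq_zero hφ _ (not_le.1 h))
  lift ν to halfPlane using hν
  obtain ⟨δ', hδ'⟩ : ∃ δ' : halfPlane, (δ' : ℂ).re = δ :=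
    ⟨⟨δ, by simpa [mem_halfPlane] using hδ.le⟩, by simp⟩
  set s : halfPlane := ν + δ' with hs
  have hsre : (s : ℂ).re = (ν : ℂ).re + δ := by
    rw [hs, AddSubmonoid.coe_add, Complex.add_re, hδ']
  obtain ⟨h, hh, C, N₀, hC, hpot⟩ := hpot (s : ℂ).re s.2
  -- The `1` puts the whole variable `x` into the truncation, `N₀` makes the potential available,
  -- and `re s + δ` keeps `lam - δ - s` in the half-plane.
  set N := max 1 (max N₀ ((s : ℂ).re + δ)) with hN
  have hN1 : 1 ≤ N := le_max_left _ _
  have hNN₀ : N₀ ≤ N := (le_max_left _ _).trans (le_max_right _ _)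
  have hNs : (s : ℂ).re + δ ≤ N := (le_max_right _ _).trans (le_max_right _ _)
  set X : Fin (n + 2) → HPoly := fun i => trunc N (tuple n ℓ φ i) with hX
  have hb2 : 0 < b / 2 := half_pos hb
  -- the radius at which the truncation is evaluated
  obtain ⟨r₀, hr₀, hr₀1, hXr₀⟩ : ∃ r₀ : ℝ, 0 < r₀ ∧ r₀ ≤ 1 ∧
      ∀ i, wnorm (powWeight r₀) (X i) ≤ b / 2 := by
    obtain ⟨r₀, h1, h2, h3⟩ := exists_rpow_le (K := ∑ i, (wnorm (fun _ => 1) (X i) : ℝ))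
      (ε := (b / 2 : ℝ≥0)) hb2 hη0 one_pos
    refine ⟨r₀, h1, h2, fun i => (wnorm_powWeight_le h1 h2 (hη N i)).trans ?_⟩
    rw [← NNReal.coe_le_coe, NNReal.coe_mul, Real.coe_toNNReal _ (by positivity), mul_comm]
    refine le_trans ?_ h3
    gcongr
    exact Finset.single_le_sum (f := fun i => (wnorm (fun _ => 1) (X i) : ℝ))
      (fun _ _ => NNReal.coe_nonneg _) (Finset.mem_univ i)
  set M := ∑' d : Fin (n + 2) →₀ ℕ, ‖MvPowerSeries.coeff d f‖₊ * ∏ i, b ^ d i with hM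
  -- The summands bound the value at the truncation divided by `x ^ (2 s)`, the linear terms
  -- (Cauchy's estimate times the tail bound `b / 2`), and the quadratic remainder. As `K` involves
  -- only `r₀`, the radius `r` can be chosen after it.
  set K : ℝ≥0 := Real.toNNReal (r₀ ^ (-((s + s : halfPlane) : ℂ).re)) * M +
    ∑ _j : Fin (n + 1), Real.toNNReal (r₀ ^ (-(s : ℂ).re)) * ((b / 2)⁻¹ * M) * (b / 2) + M with hK
  obtain ⟨r, hr, hrr₀, hrK⟩ := exists_rpow_le (K := (n + 1) * C * K) (ε := (b / 2 : ℝ≥0))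
    hb2 hδ hr₀
  have hstep : ∀ k : ℕ, partialSum hφ n ℓ r h (s : ℂ).re N (N + k * δ) ≤ b / 2 := by
    intro k
    induction k with
    | zero =>
      -- The interval `(N, N]` contains no exponents.
      refine le_trans (le_of_eq ?_) zero_le
      refine Finset.sum_eq_zero fun μ hμ => ?_
      have := (mem_expFinset.1 hμ).2
      simp only [Nat.cast_zero, zero_mul, add_zero] at this
      linarith [this.1, this.2]
    | succ k ih =>
      -- With this cutoff the tail norm is controlled by the sum up to `N + k δ`, and the recursive
      -- estimate reaches `N + (k + 1) δ`. The polynomial `P` depends on `k`, but is dominated by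
      -- `f` uniformly.
      set c := N + k * δ - (s : ℂ).re with hc
      set B := N + k * δ + (s : ℂ).re with hB
      have hs0 := re_nonneg s
      have hNB : N ≤ B := by
        have : 0 ≤ k * δ := by positivity
        linarith
      obtain ⟨D, hD⟩ := exists_nat_gt ((B + η) / η)
      rw [div_lt_iff₀ hη0] at hD
      set P := MvPowerSeries.truncTotal D f with hPdef
      have hPle : ∀ d, ‖MvPolynomial.coeff d P‖₊ ≤ ‖MvPowerSeries.coeff d f‖₊ := by
        intro d
        rw [hPdef, MvPowerSeries.coeff_truncTotal_eq_ite]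
        split_ifs
        · exact le_rfl
        · simp
      have hP : ∀ d : Fin (n + 2) →₀ ℕ, d.degree * η ≤ B + η →
          P.coeff d = MvPowerSeries.coeff d f := fun d hd =>
        MvPowerSeries.coeff_truncTotal f
          (by exact_mod_cast lt_of_mul_lt_mul_right (hd.trans_lt hD) hη0.le)
      have hw := isAlgNorm_weight hr hh c
      have hp := isAlgNorm_powWeight hr₀
      have htail : ∀ i, wnorm (weight r h c) (tail n ℓ φ N B s i) ≤ b / 2 := by
        refine Fin.cases ?_ fun j => ?_
        · rw [tail_zero hφ hN1 hNB, wnorm_zero]; exact zero_le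
        · refine (wnorm_tail_le hφ hNB j).trans ?_
          rwa [hc, sub_add_cancel]
      have hmain := partialSum_le hφ hsol hA (hδ' ▸ hδ) hs
        (fun j μ hμ hre => hgap j μ hμ (hre.trans_eq hsre)) (c := c) hN1 (hδ' ▸ hNs) hNB
        (by linarith) hη0 hη hP hr hC.le
        (fun lam hlam hre t ht htl j => hpot lam hlam (hNN₀.trans_lt hre) t ht htl j)
      rw [hδ', hc, sub_add_cancel, add_assoc, ← add_one_mul, ← Nat.cast_succ, ← hc] at hmain
      refine hmain.trans ?_
      have hbound : Real.toNNReal ((n + 1) * C * r ^ δ) * K ≤ b / 2 := by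
        rw [← NNReal.coe_le_coe, NNReal.coe_mul, Real.coe_toNNReal _ (by positivity)]
        refine le_trans (le_of_eq ?_) hrK
        ring
      refine le_trans (mul_le_mul' le_rfl ?_) hbound
      rw [hK]
      refine add_le_add (add_le_add ?_ (Finset.sum_le_sum fun j _ => ?_)) ?_
      · refine (wnorm_weight_divOf_le hr hrr₀ hh c _ _).trans (mul_le_mul' le_rfl ?_)
        exact hp.aeval_le_tsum _ P (fun i => (hXr₀ i).trans (half_le_self b.2)) hPle hsum
      · refine (hw.mul_le _ _).trans (mul_le_mul' ?_ (htail j.succ))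
        refine (wnorm_weight_divOf_le hr hrr₀ hh c _ _).trans (mul_le_mul' le_rfl ?_)
        exact norm_aeval_pderiv_le hp hb hXr₀ hPle hsum _
      · refine (norm_eval_le hw _ ?_).trans ((polyNorm_divX_le hw _).trans
          ((polyNorm_divX_le hw _).trans (polyNorm_expansion_le hw (fun i => ?_) hPle hsum)))
        · rw [wnorm_single, nnnorm_one, one_mul]
          exact weight_le_one hr (hrr₀.trans hr₀1) hh c s
        · refine (add_le_add ((wnorm_mono (weight_le_powWeight hr hrr₀ hh c) _).trans (hXr₀ i))
            (htail i)).trans (add_halves b).le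
  obtain ⟨L, hL⟩ := hh.linear
  -- Linear growth `h t ≤ L t` gives `r₁ ^ t ≤ r ^ t e ^ (-h t)`.
  set r₁ := r * Real.exp (-L) with hr₁
  have hr₁0 : 0 < r₁ := by positivity
  refine ⟨r₁, hr₁0, ?_⟩
  set g : ℂ → ℝ := fun μ => ‖φ μ‖ * r₁ ^ μ.re with hg
  have hg0 : ∀ μ, 0 ≤ g μ := fun μ => by positivity
  refine summable_of_sum_le (c := ∑ μ ∈ (hφ.2 N).toFinset, g μ + r₁ ^ (s : ℂ).re * (b / 2 : ℝ≥0))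
    hg0 fun T => ?_
  obtain ⟨B, hB⟩ : ∃ B, ∀ μ ∈ T, μ.re ≤ B := by
    obtain ⟨B, hB⟩ := (T.finite_toSet.image Complex.re).bddAbove
    exact ⟨B, fun μ hμ => hB ⟨μ, hμ, rfl⟩⟩
  obtain ⟨k, hk⟩ := exists_nat_gt ((B - N) / δ)
  rw [div_lt_iff₀ hδ] at hk
  set E := expFinset hφ N (N + k * δ) with hE
  have h1 : ∑ μ ∈ T, g μ ≤ ∑ μ ∈ (hφ.2 N).toFinset ∪ E, g μ := by
    rw [← Finset.sum_filter_of_ne (p := fun μ => φ μ ≠ 0) fun μ _ h h0 => h (by simp [hg, h0])]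
    refine Finset.sum_le_sum_of_subset_of_nonneg (fun μ hμ => ?_) fun μ _ _ => hg0 μ
    obtain ⟨hμ, hφμ⟩ := Finset.mem_filter.1 hμ
    rw [Finset.mem_union, Set.Finite.mem_toFinset, hE, mem_expFinset]
    rcases le_or_gt μ.re N with h' | h'
    · exact Or.inl ⟨hφμ, h'⟩
    · exact Or.inr ⟨hφμ, h', by linarith [hB μ hμ]⟩
  have h2 : ∑ μ ∈ (hφ.2 N).toFinset ∪ E, g μ ≤ ∑ μ ∈ (hφ.2 N).toFinset, g μ + ∑ μ ∈ E, g μ := by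
    rw [← Finset.sum_union_inter]
    exact le_add_of_nonneg_right (Finset.sum_nonneg fun μ _ => hg0 μ)
  refine h1.trans (h2.trans ?_)
  gcongr
  have h3 : (partialSum hφ n ℓ r h (s : ℂ).re N (N + k * δ) : ℝ) ≤ (b / 2 : ℝ≥0) :=
    NNReal.coe_le_coe.2 (hstep k)
  refine le_trans ?_ (mul_le_mul_of_nonneg_left h3 (by positivity))
  rw [partialSum, NNReal.coe_sum, Finset.mul_sum]
  refine Finset.sum_le_sum fun μ hμ => ?_
  have hμN := (mem_expFinset.1 hμ).2.1
  have ht : 0 ≤ μ.re - (s : ℂ).re := by linarith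
  have h4 : (1 : ℝ) ≤ powSum n (Complex.exp (μ * ℓ)) := by
    rw [powSum]
    refine le_trans (le_of_eq ?_) (NNReal.coe_le_coe.2 (Finset.single_le_sum
      (f := fun j : Fin (n + 1) => ‖Complex.exp (μ * ℓ)‖₊ ^ (j : ℕ))
      (fun _ _ => zero_le) (Finset.mem_univ 0)))
    simp
  have h5 : r₁ ^ (μ.re - (s : ℂ).re) ≤ damping r h (μ.re - (s : ℂ).re) := by
    rw [coe_damping hr.le, hr₁, Real.mul_rpow hr.le (Real.exp_pos _).le, ← Real.exp_mul]
    gcongr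
    have := hL _ ht
    linarith
  push_cast
  calc g μ = r₁ ^ (s : ℂ).re * (‖φ μ‖ * 1 * r₁ ^ (μ.re - (s : ℂ).re)) := by
        rw [Real.rpow_sub hr₁0, hg]
        field_simp
    _ ≤ _ := by gcongr

end

section

open AddMonoidAlgebra

/-! ### Resonances and rationality of the exponents -/

/-- The linear map `x ^ κ ↦ χ κ x ^ κ`. -/
def expLinearMap (χ : ℂ →ₗ[ℚ] ℚ) : HPoly →ₗ[ℂ] HPoly where
  toFun p := .ofCoeff (Finsupp.onFinset p.coeff.support (fun κ => (χ κ : ℂ) * p.coeff κ)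
    fun _ h => Finsupp.mem_support_iff.2 (right_ne_zero_of_mul h))
  map_add' p q := by ext κ; exact mul_add _ _ _
  map_smul' c p := by ext κ; exact mul_left_comm _ _ _

theorem coeff_expLinearMap (χ : ℂ →ₗ[ℚ] ℚ) (p : HPoly) (κ : halfPlane) :
    (expLinearMap χ p).coeff κ = χ κ * p.coeff κ := rfl

theorem expLinearMap_single (χ : ℂ →ₗ[ℚ] ℚ) (κ : halfPlane) (c : ℂ) :
    expLinearMap χ (single κ c) = single κ (χ κ * c) := by
  ext a
  rw [coeff_expLinearMap, coeff_single, coeff_single]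
  by_cases h : a = κ
  · rw [h, Finsupp.single_eq_same, Finsupp.single_eq_same]
  · rw [Finsupp.single_eq_of_ne h, Finsupp.single_eq_of_ne h, mul_zero]

/-- The derivation `x ^ κ ↦ χ κ x ^ κ`. -/
def expDerivation (χ : ℂ →ₗ[ℚ] ℚ) : Derivation ℂ HPoly HPoly :=
  Derivation.mk' (expLinearMap χ) fun p q => by
    induction p using AddMonoidAlgebra.induction_linear with
    | zero => simp
    | add p p' hp hp' => rw [add_mul, map_add, hp, hp', map_add, add_smul, smul_add]; abel
    | single a c =>
      induction q using AddMonoidAlgebra.induction_linear with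
      | zero => simp
      | add q q' hq hq' => rw [mul_add, map_add, hq, hq', map_add, add_smul, smul_add]; abel
      | single b d =>
        simp only [single_mul_single, expLinearMap_single, smul_eq_mul, AddSubmonoid.coe_add,
          map_add, Rat.cast_add]
        rw [add_comm b a, ← single_add]
        congr 1
        ring

theorem coeff_expDerivation (χ : ℂ →ₗ[ℚ] ℚ) (p : HPoly) (κ : halfPlane) :
    (expDerivation χ p).coeff κ = χ κ * p.coeff κ := rfl

/-- If an additive functional that vanishes at `1` does not vanish at all exponents of a solution,
then the characteristic polynomial has a root of the form `q ^ μ` with an exponent `μ`. -/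
theorem exists_resonance {n : ℕ} {ℓ : ℂ} {φ : ℂ → ℂ} (hφ : IsGenPowerSeries φ)
    {f : MvPowerSeries (Fin (n + 2)) ℂ} (hsol : ∀ μ, subst f (tuple n ℓ φ) μ = 0)
    {ν : ℂ} {A : Fin (n + 1) → ℂ}
    (hA : ∀ j : Fin (n + 1), HasLeadingTerm
      (subst (MvPowerSeries.pderiv ℂ j.succ f) (tuple n ℓ φ)) (A j) ν)
    (hν : 0 ≤ ν.re) {χ : ℂ →ₗ[ℚ] ℚ} (hχ : χ 1 = 0) {μ : ℂ} (hμ : φ μ ≠ 0) (hχμ : χ μ ≠ 0) :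
    ∃ lam, φ lam ≠ 0 ∧ (charPoly A).eval (Complex.exp (lam * ℓ)) = 0 := by
  -- Take an exponent of least real part among those where `χ` does not vanish; the derivation
  -- removes all the exponents with `χ = 0`.
  have hg := isGenPowerSeries_tuple hφ n ℓ
  obtain ⟨lam, ⟨hlam, hχlam, -⟩, hmin⟩ := Set.exists_min_image
    {z | φ z ≠ 0 ∧ χ z ≠ 0 ∧ z.re ≤ μ.re} Complex.re
    ((hφ.2 μ.re).subset fun z hz => ⟨hz.1, hz.2.2⟩) ⟨μ, hμ, hχμ, le_rfl⟩
  have hmin' : ∀ z, φ z ≠ 0 → χ z ≠ 0 → lam.re ≤ z.re := by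
    intro z h1 h2
    rcases le_total z.re μ.re with h | h
    · exact hmin z ⟨h1, h2, h⟩
    · exact (hmin μ ⟨hμ, hχμ, le_rfl⟩).trans h
  refine ⟨lam, hlam, ?_⟩
  have hlam0 := (hφ.1 lam hlam).le
  lift ν to halfPlane using hν
  have hν0 := re_nonneg ν
  obtain ⟨k, rfl⟩ : ∃ k : halfPlane, (k : ℂ) = lam := ⟨⟨lam, hlam0⟩, rfl⟩
  obtain ⟨η, hη0, hη⟩ := exists_minRe_tuple hφ n ℓ
  set B := (ν + k : ℂ).re with hB
  rw [Complex.add_re] at hB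
  obtain ⟨D, hD⟩ := exists_nat_gt ((B + η) / η)
  rw [div_lt_iff₀ hη0] at hD
  set P := MvPowerSeries.truncTotal D f with hPdef
  have hP : ∀ d : Fin (n + 2) →₀ ℕ, d.degree * η ≤ B + η →
      P.coeff d = MvPowerSeries.coeff d f := fun d hd =>
    MvPowerSeries.coeff_truncTotal f
      (by exact_mod_cast lt_of_mul_lt_mul_right (hd.trans_lt hD) hη0.le)
  have hag := agrees_subst (B := B) (fun i => agrees_trunc (hg i)) (hη B) (g := f) (P := P)
    fun d hd => hP d (by linarith)
  have hG := agrees_aeval_pderiv hφ hη hP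
  have hX : ∀ i κ, (expDerivation χ (trunc B (tuple n ℓ φ i))).coeff κ ≠ 0 →
      χ κ ≠ 0 ∧ tuple n ℓ φ i κ ≠ 0 := by
    intro i κ h
    rw [coeff_expDerivation, coeff_trunc (hg i)] at h
    refine ⟨by exact_mod_cast left_ne_zero_of_mul h, fun h' => ?_⟩
    rw [h'] at h
    simp at h
  -- The variable `x` is a constant of the derivation because `χ 1 = 0`, so only the derivatives in
  -- the `y_j` remain.
  have hX0 : expDerivation χ (trunc B (tuple n ℓ φ 0)) = 0 := by
    ext κ
    by_contra h
    obtain ⟨h1, h2⟩ := hX 0 κ h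
    have : (κ : ℂ) = 1 := by
      by_contra h
      exact h2 (Pi.single_eq_of_ne h _)
    rw [this] at h1
    exact h1 hχ
  have hD := congrArg (fun p : HPoly => p.coeff (ν + k)) (derivation_aeval (expDerivation χ)
    (fun i => trunc B (tuple n ℓ φ i)) P)
  simp only [Fin.sum_univ_succ (n := n + 1), hX0, mul_zero, zero_add, coeff_sum,
    Finsupp.finsetSum_apply, coeff_expDerivation] at hD
  rw [hag.2 _ (by rw [AddSubmonoid.coe_add]), hsol, mul_zero] at hD
  -- At `ν + k` only one pair of exponents contributes: the second factor starts at real part `re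
  -- k`, which forces real part at most `re ν` in the first, where only `ν` occurs.
  have hterm : ∀ j : Fin (n + 1),
      (MvPolynomial.aeval (fun i => trunc B (tuple n ℓ φ i)) (MvPolynomial.pderiv j.succ P) *
        expDerivation χ (trunc B (tuple n ℓ φ j.succ))).coeff (ν + k) =
      χ k * φ k * (A j * Complex.exp (k * ℓ) ^ (j : ℕ)) := by
    intro j
    rw [coeff_mul_add_of_uniqueAdd, (hG j.succ).2 ν (by linarith [re_nonneg k]), (hA j).1,
      coeff_expDerivation, coeff_trunc (hg _), if_pos (by linarith), tuple_succ]
    · ring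
    · intro a b ha hb hab
      have hbre : (k : ℂ).re ≤ (b : ℂ).re := by
        obtain ⟨h1, h2⟩ := hX j.succ b (Finsupp.mem_support_iff.1 hb)
        rw [tuple_succ] at h2
        exact hmin' b (right_ne_zero_of_mul h2) h1
      have hre := congrArg (fun z : halfPlane => (z : ℂ).re) hab
      simp only [AddSubmonoid.coe_add, Complex.add_re] at hre
      have ha0 : a = ν := by
        by_contra h
        refine Finsupp.mem_support_iff.1 ha ?_
        rw [(hG j.succ).2 a (by linarith [re_nonneg b])]
        exact (hA j).2 a (fun h' => h (Subtype.ext h')) (by linarith)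
      exact ⟨ha0, add_left_cancel (ha0 ▸ hab)⟩
  rw [Finset.sum_congr rfl fun j _ => hterm j, ← Finset.mul_sum] at hD
  have hL : (charPoly A).eval (Complex.exp (k * ℓ)) =
      ∑ j : Fin (n + 1), A j * Complex.exp (k * ℓ) ^ (j : ℕ) := by
    rw [charPoly, Polynomial.eval_finsetSum]
    simp
  rw [hL]
  exact (mul_eq_zero.1 hD.symm).resolve_left (mul_ne_zero (by exact_mod_cast hχlam) hlam)

/-- In the absence of resonances all exponents are rational. -/
theorem exponents_rational {n : ℕ} {ℓ : ℂ} {φ : ℂ → ℂ} (hφ : IsGenPowerSeries φ)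
    {f : MvPowerSeries (Fin (n + 2)) ℂ} (hsol : ∀ μ, subst f (tuple n ℓ φ) μ = 0)
    {ν : ℂ} {A : Fin (n + 1) → ℂ}
    (hA : ∀ j : Fin (n + 1), HasLeadingTerm
      (subst (MvPowerSeries.pderiv ℂ j.succ f) (tuple n ℓ φ)) (A j) ν)
    (hν : 0 ≤ ν.re)
    (hres : ∀ lam, φ lam ≠ 0 → (charPoly A).eval (Complex.exp (lam * ℓ)) ≠ 0)
    {μ : ℂ} (hμ : φ μ ≠ 0) : ∃ x : ℚ, μ = x := by
  by_contra hx
  have hmem : μ ∉ Submodule.span ℚ {(1 : ℂ)} := by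
    intro h
    obtain ⟨x, hx'⟩ := Submodule.mem_span_singleton.1 h
    refine hx ⟨x, ?_⟩
    rw [← hx', Rat.smul_def, mul_one]
  obtain ⟨χ, h1, h2⟩ := Submodule.exists_dual_map_eq_bot_of_notMem hmem inferInstance
  have hχ : χ 1 = 0 := by
    have : χ 1 ∈ (Submodule.span ℚ {(1 : ℂ)}).map χ :=
      Submodule.mem_map_of_mem (Submodule.mem_span_singleton_self 1)
    rw [h2] at this
    exact (Submodule.mem_bot ℚ).1 this
  obtain ⟨lam, hlam, h0⟩ := exists_resonance hφ hsol hA hν hχ hμ h1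
  exact hres lam hlam h0

theorem HasLeadingTerm.re_nonneg {n : ℕ} {ℓ : ℂ} {φ : ℂ → ℂ} (hφ : IsGenPowerSeries φ)
    {g : MvPowerSeries (Fin (n + 2)) ℂ} {ν a : ℂ}
    (h : HasLeadingTerm (subst g (tuple n ℓ φ)) a ν) (ha : a ≠ 0) : 0 ≤ ν.re := by
  by_contra h'
  exact ha (h.1 ▸ subst_tuple_eq_zero hφ _ (not_le.1 h'))

end

/-! ### Lower bounds for the divisors -/

/-- Chord against arc on the unit circle: `|e^{it} - 1| = 2 |sin (t / 2)|`, and Jordan's inequality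
applies once `t` is reduced modulo `2π` to `[-π, π]`. -/
theorem norm_exp_sub_ge {w a : ℂ} (hw : ‖Complex.exp w‖ = 1) (ha : ‖a‖ = 1) :
    ∃ k : ℤ, 2 / Real.pi * ‖w - Complex.log a - 2 * Real.pi * k * Complex.I‖ ≤
      ‖Complex.exp w - a‖ := by
  have ha0 : a ≠ 0 := by
    rw [← norm_ne_zero_iff, ha]; exact one_ne_zero
  have hre : (w - Complex.log a).re = 0 := by
    rw [Complex.norm_exp, Real.exp_eq_one_iff] at hw
    rw [Complex.sub_re, Complex.log_re, ha, Real.log_one, hw, sub_zero]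
  set y := (w - Complex.log a).im with hy
  have hwy : w - Complex.log a = y * Complex.I := by
    refine Complex.ext ?_ ?_ <;> simp [hre, hy]
  have hpi := Real.pi_pos
  set k := round (y / (2 * Real.pi)) with hk
  set t := y - 2 * Real.pi * k with ht
  have htpi : |t / 2| ≤ Real.pi / 2 := by
    have h1 := abs_sub_round (y / (2 * Real.pi))
    have h2 : t / 2 = Real.pi * (y / (2 * Real.pi) - k) := by
      rw [ht]; field_simp
    rw [h2, abs_mul, abs_of_pos hpi]
    calc _ ≤ Real.pi * (1 / 2) := by gcongr
      _ = _ := by ring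
  refine ⟨k, ?_⟩
  have e1 : w - Complex.log a - 2 * Real.pi * k * Complex.I = t * Complex.I := by
    rw [hwy, ht]; push_cast; ring
  have e2 : Complex.exp w - a = a * (Complex.exp (Complex.I * t) - 1) := by
    have h1 : Complex.exp (Complex.I * t) = Complex.exp (w - Complex.log a) := by
      rw [Complex.exp_eq_exp_iff_exists_int]
      refine ⟨-k, ?_⟩
      rw [hwy, ht]; push_cast; ring
    rw [h1, Complex.exp_sub, Complex.exp_log ha0]
    field_simp
  rw [e1, e2, norm_mul, norm_mul, Complex.norm_I, mul_one, ha, one_mul,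
    Complex.norm_exp_I_mul_ofReal_sub_one, Complex.norm_real, norm_mul, Real.norm_eq_abs,
    Real.norm_eq_abs, Real.norm_eq_abs, abs_two]
  have h2 := Real.mul_abs_le_abs_sin htpi
  rw [abs_div, abs_two] at h2
  linarith

/-- If `a = q ^ μ` exactly, a suitable multiple of `2πi` makes the left side of the condition
vanish. -/
theorem not_diophantine {τ : ℕ} {ℓ : ℂ} {ρ : Fin τ → ℂ} {m : Fin τ → ℕ} (hm : m ≠ 0) :
    ¬ Diophantine ℓ ρ (Complex.exp ((∑ i, (m i : ℂ) * ρ i) * ℓ)) := by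
  rintro ⟨c, γ, hc, hγ, h⟩
  obtain ⟨k, hk⟩ := Complex.exp_eq_exp_iff_exists_int.1
    (Complex.exp_log (Complex.exp_ne_zero ((∑ i, (m i : ℂ) * ρ i) * ℓ)))
  have h1 := h m hm (-k)
  rw [hk] at h1
  have h2 : (∑ i, (m i : ℂ) * ρ i) * ℓ - ((∑ i, (m i : ℂ) * ρ i) * ℓ +
      k * (2 * Real.pi * Complex.I)) - 2 * Real.pi * ((-k : ℤ) : ℂ) * Complex.I = 0 := by
    push_cast; ring
  rw [h2, norm_zero] at h1
  exact h1.not_ge (by positivity)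

theorem norm_exp_sum {τ : ℕ} (ℓ : ℂ) (ρ : Fin τ → ℂ) (m : Fin τ → ℕ) :
    ‖Complex.exp ((∑ i, (m i : ℂ) * ρ i) * ℓ)‖ = ∏ i, ‖Complex.exp (ρ i * ℓ)‖ ^ m i := by
  rw [Finset.sum_mul, Complex.exp_sum, norm_prod]
  refine Finset.prod_congr rfl fun i _ => ?_
  rw [mul_assoc, Complex.exp_nat_mul, norm_pow]

theorem Diophantine.norm_exp_sub_ge {τ : ℕ} {ℓ : ℂ} {ρ : Fin τ → ℂ} {a : ℂ}
    (h : Diophantine ℓ ρ a) (ha : ‖a‖ = 1) :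
    ∃ c γ : ℝ, 0 < c ∧ 0 < γ ∧ ∀ m : Fin τ → ℕ, m ≠ 0 →
      ‖Complex.exp ((∑ i, (m i : ℂ) * ρ i) * ℓ)‖ = 1 →
      c * ((∑ i, m i : ℕ) : ℝ) ^ (-γ) ≤ ‖Complex.exp ((∑ i, (m i : ℂ) * ρ i) * ℓ) - a‖ := by
  obtain ⟨c, γ, hc, hγ, h⟩ := h
  have hpi := Real.pi_pos
  refine ⟨2 / Real.pi * c, γ, by positivity, hγ, fun m hm h1 => ?_⟩
  obtain ⟨k, hk⟩ := QDiff.norm_exp_sub_ge h1 ha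
  refine le_trans ?_ hk
  rw [mul_assoc]
  exact mul_le_mul_of_nonneg_left (h m hm k).le (by positivity)

/-- Rational non-negative combinations of linearly independent numbers that are themselves rational
are proportional. -/
theorem coeff_proportional {τ : ℕ} {ρ : Fin τ → ℂ} (hind : LinearIndependent ℤ ρ) {x y : ℚ}
    {m m' : Fin τ → ℕ} (hx : (x : ℂ) = ∑ i, (m i : ℂ) * ρ i)
    (hy : (y : ℂ) = ∑ i, (m' i : ℂ) * ρ i) (i : Fin τ) : (m i : ℚ) * y = m' i * x := by
  have hind' : LinearIndependent ℚ ρ := (LinearIndependent.iff_fractionRing ℤ ℚ).1 hind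
  have h := Fintype.linearIndependent_iff.1 hind' (fun i => (m i : ℚ) * y - m' i * x) (by
    have : ∀ i, ((m i : ℚ) * y - m' i * x) • ρ i = y * ((m i : ℂ) * ρ i) - x * (m' i * ρ i) := by
      intro i
      rw [Rat.smul_def]; push_cast; ring
    simp only [this, Finset.sum_sub_distrib, ← Finset.mul_sum, ← hx, ← hy]
    ring) i
  exact sub_eq_zero.1 h

/-- The potential in the presence of small divisors. -/
theorem exists_potential_of_diophantine {τ n : ℕ} {ℓ : ℂ} {φ : ℂ → ℂ} (hφ : IsGenPowerSeries φ)
    {A : Fin (n + 1) → ℂ} (hA₀ : charPoly A ≠ 0) {ρ : Fin τ → ℂ} (hind : LinearIndependent ℤ ρ)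
    (hΓ : ∀ μ, φ μ ≠ 0 → ∃ m : Fin τ → ℕ, μ = ∑ i, (m i : ℂ) * ρ i)
    (hrat : ∀ μ, φ μ ≠ 0 → ∃ x : ℚ, μ = x)
    (hone : ∀ μ, φ μ ≠ 0 → ‖Complex.exp (μ * ℓ)‖ = 1)
    (hdio : ∀ a : ℂ, ((Polynomial.X - 1) * charPoly A).IsRoot a → ‖a‖ = 1 → Diophantine ℓ ρ a)
    (s : ℝ) : ∃ h, IsPotential h ∧ ∃ C N : ℝ, 0 < C ∧
      ∀ lam : ℂ, φ lam ≠ 0 → N < lam.re → ∀ t, 0 ≤ t → t < lam.re - s → ∀ j : Fin (n + 1),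
        ‖Complex.exp (lam * ℓ)‖ ^ (j : ℕ) * Real.exp (h t) ≤
          C * ‖(charPoly A).eval (Complex.exp (lam * ℓ))‖ * Real.exp (h (lam.re - s)) := by
  by_cases hex : ∃ μ, φ μ ≠ 0
  swap
  · exact ⟨0, .zero, 1, 0, one_pos, fun lam hlam => absurd ⟨lam, hlam⟩ hex⟩
  obtain ⟨μ₀, hμ₀⟩ := hex
  obtain ⟨x₀, rfl⟩ := hrat μ₀ hμ₀
  obtain ⟨m₀, hm₀⟩ := hΓ _ hμ₀
  have hx₀ : 0 < x₀ := by
    have := hφ.1 _ hμ₀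
    rw [Complex.ratCast_re] at this
    exact_mod_cast this
  have hx₀' : (0 : ℝ) < x₀ := by exact_mod_cast hx₀
  -- All multi-indices are proportional to `m₀`, so `M` is the constant ratio of the length of a
  -- multi-index to its exponent. The condition becomes one in the exponent alone.
  set M : ℝ := ((∑ i, m₀ i : ℕ) : ℝ) / x₀ with hM
  have hm₀0 : m₀ ≠ 0 := by
    rintro rfl
    simp only [Pi.zero_apply, Nat.cast_zero, zero_mul, Finset.sum_const_zero] at hm₀
    exact hx₀.ne' (by exact_mod_cast hm₀)
  have hM0 : 0 < M := by
    refine div_pos ?_ hx₀'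
    obtain ⟨i, hi⟩ := Function.ne_iff.1 hm₀0
    exact Nat.cast_pos.2 ((Nat.pos_of_ne_zero hi).trans_le
      (Finset.single_le_sum (fun _ _ => Nat.zero_le _) (Finset.mem_univ i)))
  set P : Set ℝ := {p | φ (p : ℂ) ≠ 0} with hP
  set u : ℝ → ℂ := fun p => Complex.exp (p * ℓ) with hu
  have hP0 : ∀ p ∈ P, 0 < p := fun p hp => by simpa using hφ.1 _ hp
  have hcoef : ∀ p ∈ P, ∃ m : Fin τ → ℕ, (p : ℂ) = ∑ i, (m i : ℂ) * ρ i ∧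
      ∀ i, (m i : ℝ) = m₀ i / x₀ * p := by
    intro p hp
    obtain ⟨m, hm⟩ := hΓ _ hp
    obtain ⟨x, hx⟩ := hrat _ hp
    have hpx : p = x := by exact_mod_cast hx
    refine ⟨m, hm, fun i => ?_⟩
    have h1 := coeff_proportional hind (hx ▸ hm) hm₀ i
    have h2 : (m i : ℝ) * x₀ = m₀ i * x := by exact_mod_cast h1
    rw [hpx]
    field_simp
    exact h2
  have hsumM : ∀ (m : Fin τ → ℕ) (p : ℝ), (∀ i, (m i : ℝ) = m₀ i / x₀ * p) →
      ((∑ i, m i : ℕ) : ℝ) = M * p := by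
    intro m p h
    rw [Nat.cast_sum, Finset.sum_congr rfl fun i _ => h i, ← Finset.sum_mul, ← Finset.sum_div,
      hM, Nat.cast_sum]
  have hne : ∀ (m : Fin τ → ℕ) (p : ℝ), 0 < p → (∀ i, (m i : ℝ) = m₀ i / x₀ * p) → m ≠ 0 := by
    rintro m p hp h rfl
    have h1 := hsumM 0 p h
    simp only [Pi.zero_apply, Finset.sum_const_zero, Nat.cast_zero] at h1
    exact (mul_pos hM0 hp).ne h1
  have hgap : ∃ c γ : ℝ, 0 < c ∧ 0 < γ ∧ ∀ p ∈ P, ∀ p' ∈ P, p < p' →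
      c * (p' - p) ^ (-γ) ≤ ‖u p' - u p‖ := by
    -- The factor `z - 1` is there for this: the condition at the root `1`, applied to the exponent
    -- `p' - p`, separates `q ^ p'` from `q ^ p`.
    obtain ⟨c, γ, hc, hγ, h⟩ := (hdio 1 (by simp) (by simp)).norm_exp_sub_ge (by simp)
    refine ⟨c * M ^ (-γ), γ, by positivity, hγ, fun p hp p' hp' hpp' => ?_⟩
    obtain ⟨m, hm, hmp⟩ := hcoef p hp
    obtain ⟨m', hm', hmp'⟩ := hcoef p' hp'
    -- By proportionality the larger exponent has the larger multi-index in every component, so the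
    -- difference is again an admissible multi-index.
    have hle : ∀ i, m i ≤ m' i := by
      intro i
      have h1 : (m i : ℝ) ≤ m' i := by
        rw [hmp, hmp']
        gcongr
      exact_mod_cast h1
    have hd : ∀ i, ((m' i - m i : ℕ) : ℝ) = m₀ i / x₀ * (p' - p) := by
      intro i
      rw [Nat.cast_sub (hle i), hmp, hmp']; ring
    have hsub : (∑ i, ((m' i - m i : ℕ) : ℂ) * ρ i) = p' - p := by
      rw [hm, hm', ← Finset.sum_sub_distrib]
      exact Finset.sum_congr rfl fun i _ => by rw [Nat.cast_sub (hle i)]; ring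
    have hu1 : ‖u p‖ = 1 := hone _ hp
    have hu1' : ‖u p'‖ = 1 := hone _ hp'
    have hquot : Complex.exp ((p' - p) * ℓ) = u p' / u p := by
      rw [sub_mul, Complex.exp_sub]
    have h2 := h (fun i => m' i - m i) (hne _ _ (sub_pos.2 hpp') hd)
      (by rw [hsub, hquot, norm_div, hu1, hu1', div_one])
    rw [hsub, hquot, hsumM _ _ hd, Real.mul_rpow hM0.le (sub_pos.2 hpp').le, ← mul_assoc] at h2
    refine h2.trans (le_of_eq ?_)
    have : u p' - u p = (u p' / u p - 1) * u p := by
      rw [sub_mul, div_mul_cancel₀ _ (Complex.exp_ne_zero _), one_mul]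
    rw [this, norm_mul, hu1, mul_one]
  obtain ⟨c', γ', hc', hγ', hgap⟩ := hgap
  obtain ⟨η, hη, hηφ⟩ := hφ.exists_le_re
  have hroots : ∀ a ∈ (charPoly A).roots, ∃ c γ : ℝ, 0 < c ∧ 0 < γ ∧
      ∀ p ∈ P, c * p ^ (-γ) ≤ ‖u p - a‖ := by
    intro a ha
    by_cases ha1 : ‖a‖ = 1
    · have hroot : ((Polynomial.X - 1) * charPoly A).IsRoot a := by
        rw [Polynomial.IsRoot, Polynomial.eval_mul, (Polynomial.isRoot_of_mem_roots ha).eq_zero,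
          mul_zero]
      obtain ⟨c, γ, hc, hγ, h⟩ := (hdio a hroot ha1).norm_exp_sub_ge ha1
      refine ⟨c * M ^ (-γ), γ, by positivity, hγ, fun p hp => ?_⟩
      obtain ⟨m, hm, hmp⟩ := hcoef p hp
      have h1 := h m (hne m p (hP0 p hp) hmp) (by rw [← hm]; exact hone _ hp)
      rwa [← hm, hsumM m p hmp, Real.mul_rpow hM0.le (hP0 p hp).le, ← mul_assoc] at h1
    -- A root off the unit circle produces no small divisors; the constant bound is put into the
    -- form `c p ^ (-1)` using `p ≥ η`.
    · have h0 : 0 < |1 - ‖a‖| := abs_pos.2 (sub_ne_zero.2 (Ne.symm ha1))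
      refine ⟨|1 - ‖a‖| * η, 1, by positivity, one_pos, fun p hp => ?_⟩
      have hηp : η ≤ p := by simpa using hηφ _ hp
      have hp0 := hP0 p hp
      have h1 : |1 - ‖a‖| ≤ ‖u p - a‖ := by
        have := abs_norm_sub_norm_le (u p) a
        rwa [show ‖u p‖ = 1 from hone _ hp] at this
      refine le_trans ?_ h1
      rw [Real.rpow_neg_one, mul_assoc]
      refine mul_le_of_le_one_right h0.le ?_
      rwa [← div_eq_mul_inv, div_le_one hp0]
  obtain ⟨h, hh, C, hC, hd⟩ := exists_potential_prod hP0 hc' hγ' hgap s _ hroots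
  have hlead : 0 < ‖(charPoly A).leadingCoeff‖ :=
    norm_pos_iff.2 (Polynomial.leadingCoeff_ne_zero.2 hA₀)
  refine ⟨h, hh, C / ‖(charPoly A).leadingCoeff‖, 2 * s, by positivity,
    fun lam hlam hN t ht htl j => ?_⟩
  obtain ⟨x, rfl⟩ := hrat lam hlam
  have hxc : ((x : ℝ) : ℂ) = x := by push_cast; rfl
  rw [Complex.ratCast_re] at hN htl ⊢
  have h1 := hd (x : ℝ) (by rw [hP, Set.mem_ofPred_eq, hxc]; exact hlam) hN.le t ht htl
  rw [hone _ hlam, one_pow, one_mul, (IsAlgClosed.splits (charPoly A)).eval_eq_prod_roots, norm_mul]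
  refine h1.trans (le_of_eq ?_)
  simp only [hu, hxc]
  field_simp

/-- Stated for the sum itself so that it also applies to the reversed coefficients, when `q ^ μ`
tends to infinity. -/
theorem exists_norm_eval_ge {n : ℕ} {A : Fin (n + 1) → ℂ} (hA : A 0 ≠ 0) :
    ∃ ε : ℝ, 0 < ε ∧ ∀ z : ℂ, ‖z‖ < ε → ‖A 0‖ / 2 ≤ ‖∑ j, A j * z ^ (j : ℕ)‖ := by
  have hcont : Continuous fun z : ℂ => ‖∑ j : Fin (n + 1), A j * z ^ (j : ℕ)‖ := by fun_prop
  have h0 : ‖∑ j : Fin (n + 1), A j * (0 : ℂ) ^ (j : ℕ)‖ = ‖A 0‖ := by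
    rw [Fin.sum_univ_succ]; simp
  have hev := (hcont.tendsto 0).eventually_const_lt (u := ‖A 0‖ / 2)
    (by rw [h0]; exact half_lt_self (norm_pos_iff.2 hA))
  obtain ⟨ε, hε, h⟩ := Metric.eventually_nhds_iff.1 hev
  exact ⟨ε, hε, fun z hz => (h (by simpa using hz)).le⟩

theorem eval_charPoly {n : ℕ} (A : Fin (n + 1) → ℂ) (z : ℂ) :
    (charPoly A).eval z = ∑ j, A j * z ^ (j : ℕ) := by
  rw [charPoly, Polynomial.eval_finsetSum]
  simp

/-- The case `q ^ μ → 0`. -/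
theorem exists_potential_of_decay {n : ℕ} {ℓ : ℂ} {φ : ℂ → ℂ} {A : Fin (n + 1) → ℂ}
    (hA : A 0 ≠ 0) {κ : ℝ} (hκ : 0 < κ) (hφκ : ∀ μ, φ μ ≠ 0 → (μ * ℓ).re ≤ -(κ * μ.re)) (s : ℝ) :
    ∃ h, IsPotential h ∧ ∃ C N : ℝ, 0 < C ∧
      ∀ lam : ℂ, φ lam ≠ 0 → N < lam.re → ∀ t, 0 ≤ t → t < lam.re - s → ∀ j : Fin (n + 1),
        ‖Complex.exp (lam * ℓ)‖ ^ (j : ℕ) * Real.exp (h t) ≤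
          C * ‖(charPoly A).eval (Complex.exp (lam * ℓ))‖ * Real.exp (h (lam.re - s)) := by
  obtain ⟨ε, hε, h⟩ := exists_norm_eval_ge hA
  have hA' := norm_pos_iff.2 hA
  refine ⟨0, .zero, 2 / ‖A 0‖, max 0 (-Real.log ε / κ), by positivity,
    fun lam hlam hN t _ _ j => ?_⟩
  have hN0 : 0 < lam.re := (le_max_left _ _).trans_lt hN
  have hN1 := (le_max_right _ _).trans_lt hN
  rw [div_lt_iff₀ hκ] at hN1
  have hre := hφκ lam hlam
  have h1 : ‖Complex.exp (lam * ℓ)‖ < ε := by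
    rw [Complex.norm_exp, ← Real.lt_log_iff_exp_lt hε]
    linarith
  have h2 : ‖Complex.exp (lam * ℓ)‖ ≤ 1 := by
    rw [Complex.norm_exp, Real.exp_le_one_iff]
    have := mul_pos hκ hN0
    linarith
  have h3 := h _ h1
  rw [eval_charPoly]
  simp only [Pi.zero_apply, Real.exp_zero, mul_one]
  refine (pow_le_one₀ (norm_nonneg _) h2).trans ?_
  rw [div_mul_eq_mul_div, le_div_iff₀ hA']
  linarith

/-- The case `q ^ μ → ∞`. -/
theorem exists_potential_of_growth {n : ℕ} {ℓ : ℂ} {φ : ℂ → ℂ} {A : Fin (n + 1) → ℂ}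
    (hA : A (Fin.last n) ≠ 0) {κ : ℝ} (hκ : 0 < κ)
    (hφκ : ∀ μ, φ μ ≠ 0 → κ * μ.re ≤ (μ * ℓ).re) (s : ℝ) :
    ∃ h, IsPotential h ∧ ∃ C N : ℝ, 0 < C ∧
      ∀ lam : ℂ, φ lam ≠ 0 → N < lam.re → ∀ t, 0 ≤ t → t < lam.re - s → ∀ j : Fin (n + 1),
        ‖Complex.exp (lam * ℓ)‖ ^ (j : ℕ) * Real.exp (h t) ≤
          C * ‖(charPoly A).eval (Complex.exp (lam * ℓ))‖ * Real.exp (h (lam.re - s)) := by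
  obtain ⟨ε, hε, h⟩ := exists_norm_eval_ge (A := fun j => A j.rev) (by simpa using hA)
  simp only [Fin.rev_zero] at h
  have hA' := norm_pos_iff.2 hA
  refine ⟨0, .zero, 2 / ‖A (Fin.last n)‖, max 0 (-Real.log ε / κ), by positivity,
    fun lam hlam hN t _ _ j => ?_⟩
  have hN0 : 0 < lam.re := (le_max_left _ _).trans_lt hN
  have hN1 := (le_max_right _ _).trans_lt hN
  rw [div_lt_iff₀ hκ] at hN1
  have hre := hφκ lam hlam
  set z := Complex.exp (lam * ℓ) with hz
  have hz0 : z ≠ 0 := Complex.exp_ne_zero _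
  have h1 : ‖z⁻¹‖ < ε := by
    rw [hz, ← Complex.exp_neg, Complex.norm_exp, ← Real.lt_log_iff_exp_lt hε, Complex.neg_re]
    linarith
  have h2 : 1 ≤ ‖z‖ := by
    rw [hz, Complex.norm_exp, Real.one_le_exp_iff]
    have := mul_pos hκ hN0
    linarith
  have h3 := h _ h1
  -- The reversed polynomial at `1 / z` has constant term `A_n`; the factor `z ^ n` absorbs all `|z|
  -- ^ j` since `|z| ≥ 1`.
  have e : (charPoly A).eval z = z ^ n * ∑ j : Fin (n + 1), A j.rev * z⁻¹ ^ (j : ℕ) := by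
    rw [eval_charPoly, Finset.mul_sum, ← Equiv.sum_comp Fin.revPerm]
    refine Finset.sum_congr rfl fun j _ => ?_
    have hj : z ^ n = z ^ (n - j) * z ^ (j : ℕ) := by
      rw [← pow_add, Nat.sub_add_cancel (Nat.lt_succ_iff.1 j.2)]
    rw [Fin.revPerm_apply, Fin.val_rev, Nat.add_sub_add_right, inv_pow, hj]
    field_simp
  rw [e, norm_mul, norm_pow]
  simp only [Pi.zero_apply, Real.exp_zero, mul_one]
  refine (pow_le_pow_right₀ h2 (Nat.lt_succ_iff.1 j.2)).trans ?_
  have h4 : 1 ≤ 2 / ‖A (Fin.last n)‖ * ‖∑ j : Fin (n + 1), A j.rev * z⁻¹ ^ (j : ℕ)‖ := by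
    rw [div_mul_eq_mul_div, le_div_iff₀ hA']
    linarith
  calc ‖z‖ ^ n = ‖z‖ ^ n * 1 := (mul_one _).symm
    _ ≤ ‖z‖ ^ n * (2 / ‖A (Fin.last n)‖ * ‖∑ j : Fin (n + 1), A j.rev * z⁻¹ ^ (j : ℕ)‖) := by
        gcongr
    _ = _ := by ring

/-! ### Convergence in sectors -/

/-- The modulus of `x ^ μ` is `exp (re μ · ln |x| - im μ · arg x)`. With `|im μ| ≤ K re μ` and a
bounded argument, the second term is compensated by shrinking the radius by `e ^ (-K Θ)`, and the
Weierstrass test applies. -/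
theorem convergesInSectors_of_summable {φ : ℂ → ℂ} {K r : ℝ} (hr : 0 < r)
    (hpos : ∀ μ, φ μ ≠ 0 → 0 ≤ μ.re) (hK : ∀ μ, φ μ ≠ 0 → |μ.im| ≤ K * μ.re)
    (hsum : Summable fun μ : ℂ => ‖φ μ‖ * r ^ μ.re) : ConvergesInSectors φ := by
  intro α β _ _
  set Θ := max |α| |β| with hΘ
  have hR : 0 < r * Real.exp (-(K * Θ)) := by positivity
  refine ⟨r * Real.exp (-(K * Θ)), hR, fun p => ∑' μ, φ μ * cpowPolar μ p,
    tendstoUniformlyOn_tsum hsum fun μ p hp => ?_⟩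
  by_cases hμ : φ μ = 0
  · simp [hμ]
  rw [norm_mul]
  gcongr
  obtain ⟨⟨hp0, hpR⟩, hα, hβ⟩ := hp
  have hlog : Real.log p.1 ≤ Real.log r - K * Θ := by
    refine (Real.log_le_log hp0 hpR.le).trans (le_of_eq ?_)
    rw [Real.log_mul hr.ne' (Real.exp_pos _).ne', Real.log_exp]
    ring
  have hθ : |p.2| ≤ Θ := by
    rw [abs_le]
    have h1 := neg_abs_le α
    have h2 := le_abs_self β
    have h3 := le_max_left |α| |β|
    have h4 := le_max_right |α| |β|
    constructor <;> linarith
  have him : -(μ.im * p.2) ≤ K * μ.re * Θ := by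
    refine (neg_le_abs _).trans ?_
    rw [abs_mul]
    exact mul_le_mul (hK μ hμ) hθ (abs_nonneg _) ((abs_nonneg _).trans (hK μ hμ))
  rw [cpowPolar, Complex.norm_exp, Real.rpow_def_of_pos hr]
  apply Real.exp_le_exp.2
  have e : (μ * ((Real.log p.1 : ℂ) + p.2 * Complex.I)).re = μ.re * Real.log p.1 - μ.im * p.2 := by
    simp [Complex.mul_re]
  rw [e]
  have := mul_le_mul_of_nonneg_left hlog (hpos μ hμ)
  linarith

/-! ### The cases of the theorem -/

theorem coeff_charPoly {n : ℕ} (A : Fin (n + 1) → ℂ) (j : Fin (n + 1)) :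
    (charPoly A).coeff j = A j := by
  simp [charPoly, Polynomial.finsetSum_coeff, Polynomial.coeff_X_pow, Fin.val_inj]

theorem exists_im_le {τ : ℕ} {φ : ℂ → ℂ} {ρ : Fin τ → ℂ} (hρ : ∀ i, 0 < (ρ i).re)
    (hΓ : ∀ μ, φ μ ≠ 0 → ∃ m : Fin τ → ℕ, μ = ∑ i, (m i : ℂ) * ρ i) :
    ∃ K : ℝ, ∀ μ, φ μ ≠ 0 → |μ.im| ≤ K * μ.re := by
  refine ⟨∑ i, |(ρ i).im| / (ρ i).re, fun μ hμ => ?_⟩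
  obtain ⟨m, rfl⟩ := hΓ μ hμ
  have hi : ∀ i, |(ρ i).im| ≤ (∑ i, |(ρ i).im| / (ρ i).re) * (ρ i).re := fun i => by
    rw [← div_le_iff₀ (hρ i)]
    exact Finset.single_le_sum (f := fun i => |(ρ i).im| / (ρ i).re)
      (fun j _ => div_nonneg (abs_nonneg _) (hρ j).le) (Finset.mem_univ i)
  rw [Complex.im_sum, Complex.re_sum, Finset.mul_sum]
  refine (Finset.abs_sum_le_sum_abs _ _).trans (Finset.sum_le_sum fun i _ => ?_)
  rw [← Complex.ofReal_natCast, Complex.im_ofReal_mul, Complex.re_ofReal_mul, abs_mul, Nat.abs_cast,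
    mul_left_comm]
  exact mul_le_mul_of_nonneg_left (hi i) (Nat.cast_nonneg _)

theorem norm_exp_lt_one_iff {z : ℂ} : ‖Complex.exp z‖ < 1 ↔ z.re < 0 := by
  rw [Complex.norm_exp, Real.exp_lt_one_iff]

theorem exists_decay_rate {τ : ℕ} {ℓ : ℂ} {φ : ℂ → ℂ} {ρ : Fin τ → ℂ} (hρ : ∀ i, 0 < (ρ i).re)
    (hΓ : ∀ μ, φ μ ≠ 0 → ∃ m : Fin τ → ℕ, μ = ∑ i, (m i : ℂ) * ρ i)
    (h : ∀ i, (ρ i * ℓ).re < 0) :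
    ∃ κ : ℝ, 0 < κ ∧ ∀ μ, φ μ ≠ 0 → (μ * ℓ).re ≤ -(κ * μ.re) := by
  obtain ⟨κ, hκ, hle⟩ := exists_pos_le (Set.finite_univ (α := Fin τ))
    (g := fun i => -(ρ i * ℓ).re / (ρ i).re) fun i _ => div_pos (neg_pos.2 (h i)) (hρ i)
  refine ⟨κ, hκ, fun μ hμ => ?_⟩
  obtain ⟨m, rfl⟩ := hΓ μ hμ
  rw [Finset.sum_mul, Complex.re_sum, Complex.re_sum, Finset.mul_sum, ← Finset.sum_neg_distrib]
  refine Finset.sum_le_sum fun i _ => ?_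
  have h1 := hle i (Set.mem_univ i)
  rw [le_div_iff₀ (hρ i)] at h1
  rw [← Complex.ofReal_natCast, mul_assoc, Complex.re_ofReal_mul, Complex.re_ofReal_mul]
  have := mul_le_mul_of_nonneg_left h1 (Nat.cast_nonneg (α := ℝ) (m i))
  linarith

/-- The Diophantine condition excludes resonances. -/
theorem eval_charPoly_ne_zero {τ n : ℕ} {ℓ : ℂ} {φ : ℂ → ℂ} (hφ : IsGenPowerSeries φ)
    {A : Fin (n + 1) → ℂ} {ρ : Fin τ → ℂ}
    (hΓ : ∀ μ, φ μ ≠ 0 → ∃ m : Fin τ → ℕ, μ = ∑ i, (m i : ℂ) * ρ i) {p : ℝ → Prop}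
    (hp : ∀ μ, φ μ ≠ 0 → p ‖Complex.exp (μ * ℓ)‖)
    (hdio : ∀ a : ℂ, ((Polynomial.X - 1) * charPoly A).IsRoot a → p ‖a‖ → Diophantine ℓ ρ a)
    (lam : ℂ) (hlam : φ lam ≠ 0) : (charPoly A).eval (Complex.exp (lam * ℓ)) ≠ 0 := by
  intro h0
  have hd := hdio _ (by rw [Polynomial.IsRoot, Polynomial.eval_mul, h0, mul_zero]) (hp lam hlam)
  obtain ⟨m, rfl⟩ := hΓ lam hlam
  refine not_diophantine ?_ hd
  rintro rfl
  simpa using hφ.1 _ hlam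

/-- Convergence in the cases with small divisors: `p` describes the absolute values of the
numbers `q ^ μ`. -/
theorem exists_potential_of_nonresonant {τ n : ℕ} {ℓ : ℂ} {φ : ℂ → ℂ} (hφ : IsGenPowerSeries φ)
    {f : MvPowerSeries (Fin (n + 2)) ℂ} (hsol : ∀ μ, subst f (tuple n ℓ φ) μ = 0)
    {ν : ℂ} {A : Fin (n + 1) → ℂ}
    (hA : ∀ j : Fin (n + 1), HasLeadingTerm
      (subst (MvPowerSeries.pderiv ℂ j.succ f) (tuple n ℓ φ)) (A j) ν)
    (hν : 0 ≤ ν.re) (hL : charPoly A ≠ 0) {ρ : Fin τ → ℂ} (hind : LinearIndependent ℤ ρ)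
    (hΓ : ∀ μ, φ μ ≠ 0 → ∃ m : Fin τ → ℕ, μ = ∑ i, (m i : ℂ) * ρ i) {p : ℝ → Prop}
    (hp : ∀ μ, φ μ ≠ 0 → p ‖Complex.exp (μ * ℓ)‖) (hp1 : p 1)
    (hdio : ∀ a : ℂ, ((Polynomial.X - 1) * charPoly A).IsRoot a → p ‖a‖ → Diophantine ℓ ρ a)
    (hneg : ∀ x < 1, p x → A 0 ≠ 0) (hpos : ∀ x > 1, p x → A (Fin.last n) ≠ 0) (s : ℝ) :
    ∃ h, IsPotential h ∧ ∃ C N : ℝ, 0 < C ∧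
      ∀ lam : ℂ, φ lam ≠ 0 → N < lam.re → ∀ t, 0 ≤ t → t < lam.re - s → ∀ j : Fin (n + 1),
        ‖Complex.exp (lam * ℓ)‖ ^ (j : ℕ) * Real.exp (h t) ≤
          C * ‖(charPoly A).eval (Complex.exp (lam * ℓ))‖ * Real.exp (h (lam.re - s)) := by
  have hrat : ∀ μ, φ μ ≠ 0 → ∃ x : ℚ, μ = x := fun μ hμ =>
    exponents_rational hφ hsol hA hν (eval_charPoly_ne_zero hφ hΓ hp hdio) hμ
  have hre : ∀ μ, φ μ ≠ 0 → (μ * ℓ).re = ℓ.re * μ.re := by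
    intro μ hμ
    obtain ⟨x, rfl⟩ := hrat μ hμ
    simp [mul_comm]
  by_cases hex : ∃ μ, φ μ ≠ 0
  swap
  · exact ⟨0, .zero, 1, 0, one_pos, fun lam hlam => absurd ⟨lam, hlam⟩ hex⟩
  obtain ⟨μ₀, hμ₀⟩ := hex
  have hμ₀' := hφ.1 _ hμ₀
  have hp₀ := hp _ hμ₀
  -- As all exponents are positive rationals, `|q ^ μ| = e ^ (μ re ℓ)`: one of decay, growth and
  -- modulus one holds for all exponents at once.
  rcases lt_trichotomy ℓ.re 0 with hℓ | hℓ | hℓ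
  · refine exists_potential_of_decay (hneg _ ?_ hp₀) (neg_pos.2 hℓ) (fun μ hμ => ?_) s
    · rw [norm_exp_lt_one_iff, hre _ hμ₀]
      exact mul_neg_of_neg_of_pos hℓ hμ₀'
    · rw [hre _ hμ, neg_mul, neg_neg]
  · have hone : ∀ μ, φ μ ≠ 0 → ‖Complex.exp (μ * ℓ)‖ = 1 := fun μ hμ => by
      rw [Complex.norm_exp, hre _ hμ, hℓ, zero_mul, Real.exp_zero]
    exact exists_potential_of_diophantine hφ hL hind hΓ hrat hone
      (fun a ha h1 => hdio a ha (h1 ▸ hp1)) s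
  · refine exists_potential_of_growth (hpos _ ?_ hp₀) hℓ (fun μ hμ => (hre _ hμ).ge) s
    rw [gt_iff_lt, Complex.norm_exp, Real.one_lt_exp_iff, hre _ hμ₀]
    exact mul_pos hℓ hμ₀'

end QDiff

end

theorem mainTheorem6 (n τ : ℕ) (q ℓ : ℂ) (hq₀ : q ≠ 0) (hq₁ : q ≠ 1) (hℓ : Complex.exp ℓ = q)
    (F : (Fin (n + 2) → ℂ) → ℂ) (f : MvPowerSeries (Fin (n + 2)) ℂ)
    (hF : QDiff.HasTaylorSeries F f)
    (φ : ℂ → ℂ) (hφ : QDiff.IsGenPowerSeries φ)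
    (hsol : ∀ μ, QDiff.subst f (QDiff.tuple n ℓ φ) μ = 0)
    (ν : ℂ) (A : Fin (n + 1) → ℂ)
    (hA : ∀ j : Fin (n + 1), QDiff.HasLeadingTerm
      (QDiff.subst (MvPowerSeries.pderiv ℂ j.succ f) (QDiff.tuple n ℓ φ)) (A j) ν)
    (hA₀ : ∃ j, A j ≠ 0)
    (ρ : Fin τ → ℂ) (hρ : ∀ i, 0 < (ρ i).re) (hind : LinearIndependent ℤ ρ)
    (hΓ : ∀ μ, φ μ ≠ 0 → ∃ m : Fin τ → ℕ, μ = ∑ i, (m i : ℂ) * ρ i)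
    (hcases :
      (A 0 ≠ 0 ∧ ∀ i, ‖Complex.exp (ρ i * ℓ)‖ < 1) ∨
      (A (Fin.last n) ≠ 0 ∧ ∀ i, 1 < ‖Complex.exp (ρ i * ℓ)‖) ∨
      ((∀ i, ‖Complex.exp (ρ i * ℓ)‖ = 1) ∧
        ∀ a : ℂ, ((Polynomial.X - 1) * QDiff.charPoly A).IsRoot a → ‖a‖ = 1 →
          QDiff.Diophantine ℓ ρ a) ∨
      (A 0 ≠ 0 ∧ (∀ i, ‖Complex.exp (ρ i * ℓ)‖ ≤ 1) ∧
        ∀ a : ℂ, ((Polynomial.X - 1) * QDiff.charPoly A).IsRoot a → ‖a‖ ≤ 1 →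
          QDiff.Diophantine ℓ ρ a) ∨
      (A (Fin.last n) ≠ 0 ∧ (∀ i, 1 ≤ ‖Complex.exp (ρ i * ℓ)‖) ∧
        ∀ a : ℂ, ((Polynomial.X - 1) * QDiff.charPoly A).IsRoot a → 1 ≤ ‖a‖ →
          QDiff.Diophantine ℓ ρ a)) :
    QDiff.ConvergesInSectors φ := by
  have hν : 0 ≤ ν.re := by
    obtain ⟨j, hj⟩ := hA₀
    exact (hA j).re_nonneg hφ hj
  have hL : QDiff.charPoly A ≠ 0 := by
    obtain ⟨j, hj⟩ := hA₀
    intro h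
    rw [← QDiff.coeff_charPoly A j, h, Polynomial.coeff_zero] at hj
    exact hj rfl
  have hnorm : ∀ μ, φ μ ≠ 0 → ∃ m : Fin τ → ℕ,
      ‖Complex.exp (μ * ℓ)‖ = ∏ i, ‖Complex.exp (ρ i * ℓ)‖ ^ m i := by
    intro μ hμ
    obtain ⟨m, rfl⟩ := hΓ μ hμ
    exact ⟨m, QDiff.norm_exp_sum ℓ ρ m⟩
  obtain ⟨K, hK⟩ := QDiff.exists_im_le hρ hΓ
  obtain ⟨r, hr, hsum⟩ := QDiff.summable_of_potential hF hφ hsol hA hA₀ (by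
    intro s _
    rcases hcases with ⟨h0, h⟩ | ⟨h0, h⟩ | ⟨h, hdio⟩ | ⟨h0, h, hdio⟩ | ⟨h0, h, hdio⟩
    · obtain ⟨κ, hκ, hle⟩ := QDiff.exists_decay_rate (ℓ := ℓ) hρ hΓ
        fun i => QDiff.norm_exp_lt_one_iff.1 (h i)
      exact QDiff.exists_potential_of_decay h0 hκ hle s
    -- Replacing `ℓ` by `-ℓ` turns growth into decay.
    · obtain ⟨κ, hκ, hle⟩ := QDiff.exists_decay_rate (ℓ := -ℓ) hρ hΓ fun i => by
        have := h i
        rw [Complex.norm_exp, Real.one_lt_exp_iff] at this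
        rwa [mul_neg, Complex.neg_re, neg_lt_zero]
      refine QDiff.exists_potential_of_growth h0 hκ (fun μ hμ => ?_) s
      have := hle μ hμ
      rwa [mul_neg, Complex.neg_re, neg_le_neg_iff] at this
    · refine QDiff.exists_potential_of_nonresonant hφ hsol hA hν hL hind hΓ (p := (· = 1))
        (fun μ hμ => ?_) rfl hdio (fun x hx h1 => absurd h1 hx.ne) (fun x hx h1 => absurd h1 hx.ne') s
      obtain ⟨m, hm⟩ := hnorm μ hμ
      simp [hm, h]
    · refine QDiff.exists_potential_of_nonresonant hφ hsol hA hν hL hind hΓ (p := (· ≤ 1))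
        (fun μ hμ => ?_) le_rfl hdio (fun _ _ _ => h0) (fun x hx h1 => absurd h1 hx.not_ge) s
      obtain ⟨m, hm⟩ := hnorm μ hμ
      rw [hm]
      exact Finset.prod_le_one (fun i _ => by positivity) fun i _ => pow_le_one₀ (norm_nonneg _) (h i)
    · refine QDiff.exists_potential_of_nonresonant hφ hsol hA hν hL hind hΓ (p := (1 ≤ ·))
        (fun μ hμ => ?_) le_rfl hdio (fun x hx h1 => absurd h1 hx.not_ge) (fun _ _ _ => h0) s
      obtain ⟨m, hm⟩ := hnorm μ hμ
      rw [hm]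
      exact Finset.prod_induction _ (1 ≤ ·) (fun _ _ => one_le_mul_of_one_le_of_one_le) le_rfl
        fun i _ => one_le_pow₀ (h i))
  exact QDiff.convergesInSectors_of_summable hr (fun μ hμ => (hφ.1 μ hμ).le) hK hsum
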